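/- Let $\mathbb K$ be a field of characteristic $0$. Generalized permutahedra. For a finite set $I$, a generalized permutahedron in $\mathbb R I$ is a polytope whose normal fan is a coarsening of the normal fan of the standard permutahedron $\pi_I$ (the convex hull of the points $\sum_{i\in I} f(i)e_i$ with $f:I\to\{1,\dots,|I|\}$ a bijection). Two of them are normally equivalent if they have the same normal fan. Let $\overline{\mathbf{GP}}[I]$ be the $\mathbb K$-vector space with basis the normal equivalence classes of generalized permutahedra in $\mathbb R I$, and $\mathbf P[I]$ the $\mathbb K$-vector space with basis the partial orders on $I$; both are vector species by relabelling. Brion map. The Brion map is the morphism of species $B:\overline{\mathbf{GP}}[I]\to\mathbf P[I]$, $B(P)=\sum_{v} \mathrm{poset}_v(P)$, the sum being over the vertices $v$ of $P$, where $\mathrm{poset}_v(P)$ is the poset corresponding to the tangent cone of $P$ at $v$ (the cone generated by the directions of the edges of $P$ at $v$, pointing out of $v$): $i\ge j$ in $\mathrm{poset}_v(P)$ if and only if $e_i-e_j$ lies in this cone. Associahedra. For a linear order $\ell$ on $I$, the associahedron $a_\ell\subseteq\mathbb R I$ is the Minkowski sum of the simplices $\mathrm{conv}\{e_k: i\le_\ell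 k\le_\ell j\}$ over all $i\le_\ell j$. Let $\overline{\mathbf A}[I]\subseteq\overline{\mathbf{GP}}[I]$ be the span of the classes of the products $a_{\ell_1}\times\cdots\times a_{\ell_k}$, where $I=S_1\sqcup\cdots\sqcup S_k$ and $\ell_b$ is a linear order on $S_b$. The Fock functor sends a species $\mathbf H$ to the graded space $\bigoplus_{n\ge 0}\mathbf H[\{1,\dots,n\}]_{S_n}$ of coinvariants (which forgets the labels). Let $A$ and $\mathcal P$ be the images of $\overline{\mathbf A}$ and $\mathbf P$ (the Hopf algebras of associahedra and of posets), let $B:A\to \mathcal P$ be the linear map induced by the Brion map, and let $a_n\in A$ be the class of the associahedron of $\{1<2<\dots<n\}$. Rooted binary tree posets. A rooted binary tree is either empty or consists of a root, a left sub-tree and a right sub-tree, which are rooted binary trees. The poset of a rooted binary tree has the (internal) vertices of the tree as elements; the root is its minimum, and above the root stand the posets of the left and of the right sub-tree, with no relations between the two. Let $\mathrm{RBT}_n$ be the set of isomorphism classes of posets of rooted binary trees with $n$ (internal) vertices. For a finite poset $p$ let $m(p)$ be the number of maximal elements of $p$, and $s(p)$ the number of symmetric elements, i.e. of those $v\in p$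 which are covered by two distinct elements $v_1,v_2$ such that the sub-posets $p_{\ge v_1}$ and $p_{\ge v_2}$ are isomorphic. Theorem. For every integer $n\ge 0$, $$B(a_n)=\sum_{p\in \mathrm{RBT}_n}2^{\,n-m(p)-s(p)}\,p \quad\text{in } \mathcal P,$$ where an isomorphism class $p$ of posets on $n$ elements stands for the class in $\mathcal P$ of any of its labellings by $\{1,\dots,n\}$. -/

import Mathlib

open scoped Pointwise

universe u

namespace BrionMap

/-! ### Polytopes in `ℝI`, faces, normal fans -/

/-- The standard basis vector `e_k` of `ℝI`. -/
noncomputable def stdVec {I : Type} (k : I) : I → ℝ :=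
  open Classical in Pi.single k 1

/-- The `y`-maximal face of `P`, where the linear functional `y ∈ (ℝI)^*` is a function `I → ℝ`. -/
def maxFace {I : Type} [Fintype I] (P : Set (I → ℝ)) (y : I → ℝ) : Set (I → ℝ) :=
  {x | x ∈ P ∧ ∀ z ∈ P, y ⬝ᵥ z ≤ y ⬝ᵥ x}

/-- The (nonempty) faces of `P`: the sets on which some linear functional is maximal. -/
def IsFace {I : Type} [Fintype I] (P F : Set (I → ℝ)) : Prop :=
  F.Nonempty ∧ ∃ y, F = maxFace P y

/-- The normal cone of `F`: the functionals that attain their maximum over `P` at every point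
of `F`. -/
def normalCone {I : Type} [Fintype I] (P F : Set (I → ℝ)) : Set (I → ℝ) :=
  {y | ∀ x ∈ F, ∀ z ∈ P, y ⬝ᵥ z ≤ y ⬝ᵥ x}

/-- The normal fan of `P`: the collection of the normal cones of all faces of `P`. -/
def normalFan {I : Type} [Fintype I] (P : Set (I → ℝ)) : Set (Set (I → ℝ)) :=
  {C | ∃ F, IsFace P F ∧ C = normalCone P F}

/-- The collection of cones `𝒢` is a coarsening of `ℱ`. -/
def IsCoarsening {I : Type} (𝒢 ℱ : Set (Set (I → ℝ))) : Prop :=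
  ∀ C ∈ ℱ, ∃ D ∈ 𝒢, C ⊆ D

/-- A polytope: the convex hull of a nonempty finite set of points. -/
def IsPolytope {I : Type} (P : Set (I → ℝ)) : Prop :=
  ∃ S : Set (I → ℝ), S.Finite ∧ S.Nonempty ∧ P = convexHull ℝ S

/-- The standard permutahedron `π_I`: the convex hull of the points `∑ f(i) e_i`, where `f` runs
over the bijections from `I` to `{1, …, |I|}`. -/
def permutahedron (I : Type) [Fintype I] : Set (I → ℝ) :=
  convexHull ℝ {x | ∃ f : I ≃ Fin (Fintype.card I), ∀ i, x i = ((f i : ℕ) : ℝ) + 1}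

/-- Generalized permutahedra in `ℝI`: polytopes whose normal fan is a coarsening of the braid fan,
the normal fan of the standard permutahedron. -/
structure GenPerm (I : Type) [Fintype I] where
  carrier : Set (I → ℝ)
  isPolytope : IsPolytope carrier
  coarsens : IsCoarsening (normalFan carrier) (normalFan (permutahedron I))

/-! ### Vertices, edges, tangent cones and the associated posets -/

/-- `v` is a vertex of `P`. -/
def IsVertex {I : Type} [Fintype I] (P : Set (I → ℝ)) (v : I → ℝ) : Prop :=
  IsFace P {v}

/-- The segment from `v` to `w` is an edge of `P`. -/
def IsEdge {I : Type} [Fintype I] (P : Set (I → ℝ)) (v w : I → ℝ) : Prop :=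
  v ≠ w ∧ IsFace P (segment ℝ v w)

/-- The tangent cone of `P` at the vertex `v`: the cone generated by the directions of the edges
of `P` at `v`, oriented to point out of `v`. -/
def tangentCone {I : Type} [Fintype I] (P : Set (I → ℝ)) (v : I → ℝ) : PointedCone ℝ (I → ℝ) :=
  PointedCone.hull ℝ {d | ∃ w, IsEdge P v w ∧ d = w - v}

/-- The poset cone `cone(e_i - e_j : i ≥ j in p)`. -/
noncomputable def posetCone {I : Type} (p : PartialOrder I) : PointedCone ℝ (I → ℝ) :=
  PointedCone.hull ℝ {d | ∃ i j : I, p.le j i ∧ d = stdVec i - stdVec j}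

theorem dot_stdVec {I : Type} [Fintype I] (y : I → ℝ) (k : I) : y ⬝ᵥ stdVec k = y k := by
  classical
  have : (stdVec k : I → ℝ) = Pi.single k 1 := by unfold stdVec; congr!
  rw [this]; simp

/-- A linear functional that is nonnegative on generators is nonnegative on the cone. -/
theorem dot_nonneg_of_mem_hull {I : Type} [Fintype I] {S : Set (I → ℝ)} {y : I → ℝ}
    (h : ∀ d ∈ S, 0 ≤ y ⬝ᵥ d) {d : I → ℝ} (hd : d ∈ PointedCone.hull ℝ S) : 0 ≤ y ⬝ᵥ d := by
  induction hd using Submodule.span_induction with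
  | mem x hx => exact h x hx
  | zero => simp
  | add x z _ _ hx hz => rw [dotProduct_add]; exact add_nonneg hx hz
  | smul a x _ hx =>
    have : a • x = (a : ℝ) • x := rfl
    rw [this, dotProduct_smul]
    exact mul_nonneg a.2 hx

theorem pos_of_mem_tangentCone {I : Type} [Fintype I] {P : Set (I → ℝ)} {v : I → ℝ}
    (hv : IsVertex P v) : ∃ y : I → ℝ, ∀ d ∈ tangentCone P v, (y ⬝ᵥ d ≤ 0 ∧ (y ⬝ᵥ d = 0 → d = 0)) := by
  obtain ⟨-, y, hy⟩ := hv
  have hvP : v ∈ maxFace P y := by rw [← hy]; rfl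
  have key : ∀ w ∈ P, w ≠ v → y ⬝ᵥ w < y ⬝ᵥ v := by
    intro w hw hne
    refine lt_of_le_of_ne (hvP.2 w hw) fun h => hne ?_
    have : w ∈ maxFace P y := ⟨hw, fun z hz => h ▸ hvP.2 z hz⟩
    rw [← hy] at this
    exact this
  refine ⟨y, fun d hd => ?_⟩
  induction hd using Submodule.span_induction with
  | mem x hx =>
    obtain ⟨w, ⟨hne, -, y', hw⟩, rfl⟩ := hx
    have hwP : w ∈ maxFace P y' := hw ▸ right_mem_segment ℝ v w
    have := key w hwP.1 hne.symm
    rw [dotProduct_sub]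
    exact ⟨by linarith, fun h => by linarith⟩
  | zero => simp
  | add x z _ _ hx hz =>
    rw [dotProduct_add]
    refine ⟨by linarith [hx.1, hz.1], fun h => ?_⟩
    rw [hx.2 (by linarith [hx.1, hz.1]), hz.2 (by linarith [hx.1, hz.1]), add_zero]
  | smul a x _ hx =>
    have : a • x = (a : ℝ) • x := rfl
    rw [this, dotProduct_smul, smul_eq_mul]
    refine ⟨mul_nonpos_of_nonneg_of_nonpos a.2 hx.1, fun h => ?_⟩
    rcases mul_eq_zero.1 h with h | h
    · rw [h, zero_smul]
    · rw [hx.2 h, smul_zero]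

/-- `poset_v(P)`: the poset corresponding to the tangent cone of `P` at the vertex `v`, with
`i ≥ j` if and only if `e_i - e_j` lies in the tangent cone. See `vertexPoset_eq`: it is the only
partial order on `I` whose poset cone can be the tangent cone. -/
@[reducible] def vertexPoset {I : Type} [Fintype I] (P : Set (I → ℝ)) (v : I → ℝ) (hv : IsVertex P v) :
    PartialOrder I where
  le j i := stdVec i - stdVec j ∈ tangentCone P v
  le_refl i := by rw [sub_self]; exact Submodule.zero_mem _
  le_trans i j k hij hjk := by
    have := Submodule.add_mem _ hjk hij
    rwa [sub_add_sub_cancel] at this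
  le_antisymm j i h1 h2 := by
    obtain ⟨y, hy⟩ := pos_of_mem_tangentCone hv
    have e1 := (hy _ h1).1
    have e2 := (hy _ h2).1
    have e3 := (hy _ h1).2
    rw [dotProduct_sub] at e1 e2 e3
    have h0 : stdVec i - stdVec j = (0 : I → ℝ) := e3 (by linarith)
    by_contra hne
    have h1 := dot_stdVec (stdVec j) i
    rw [sub_eq_zero.1 h0, dot_stdVec] at h1
    simp [stdVec, Ne.symm hne] at h1

theorem mem_posetCone {I : Type} [Fintype I] (p : PartialOrder I) (i j : I) :
    stdVec i - stdVec j ∈ posetCone p ↔ p.le j i := by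
  constructor
  · intro h
    classical
    let y : I → ℝ := fun k => if p.le j k then 1 else 0
    have := dot_nonneg_of_mem_hull (y := y) (S := {d | ∃ i j : I, p.le j i ∧ d = stdVec i - stdVec j})
      (by
        rintro _ ⟨a, b, hab, rfl⟩
        rw [dotProduct_sub, dot_stdVec, dot_stdVec]
        simp only [y]
        by_cases h2 : p.le j b
        · simp [h2, p.le_trans _ _ _ h2 hab]
        · by_cases h1 : p.le j a <;> simp [h1, h2]) h
    rw [dotProduct_sub, dot_stdVec, dot_stdVec] at this
    by_contra hne
    have h1 : p.le j j := p.le_refl j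
    simp only [y, hne, h1, if_true, if_false] at this
    norm_num at this
  · intro h
    exact Submodule.subset_span ⟨i, j, h, rfl⟩

theorem vertexPoset_eq {I : Type} [Fintype I] (P : Set (I → ℝ)) (v : I → ℝ) (hv : IsVertex P v)
    (p : PartialOrder I) (h : posetCone p = tangentCone P v) : vertexPoset P v hv = p := by
  refine PartialOrder.ext fun j i => ?_
  rw [← mem_posetCone p i j, h]
  rfl

theorem finite_isVertex {I : Type} [Fintype I] {P : Set (I → ℝ)} (hP : IsPolytope P) :
    {v | IsVertex P v}.Finite := by
  obtain ⟨S, hS, -, rfl⟩ := hP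
  refine hS.subset ?_
  rintro v ⟨-, y, hy⟩
  by_contra hv
  have hvP : v ∈ maxFace (convexHull ℝ S) y := by rw [← hy]; rfl
  have hcv : Convex ℝ {z : I → ℝ | y ⬝ᵥ z < y ⬝ᵥ v} :=
    convex_halfSpace_lt ⟨fun a b => dotProduct_add _ _ _, fun c a => dotProduct_smul _ _ _⟩ _
  have : convexHull ℝ S ⊆ {z : I → ℝ | y ⬝ᵥ z < y ⬝ᵥ v} := by
    refine convexHull_min (fun s hs => ?_) hcv
    have hs' := subset_convexHull ℝ S hs
    refine lt_of_le_of_ne (hvP.2 s hs') fun h => hv ?_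
    have : s ∈ maxFace (convexHull ℝ S) y := ⟨hs', fun z hz => h ▸ hvP.2 z hz⟩
    rw [← hy] at this
    rw [← show s = v from this]
    exact hs
  exact lt_irrefl (y ⬝ᵥ v) (this hvP.1)

/-! ### Normally equivalent polytopes have the same vertex posets -/

theorem segment_subset_maxFace {I : Type} [Fintype I] {P : Set (I → ℝ)} (hP : IsPolytope P)
    {y v w : I → ℝ} (h : maxFace P y = segment ℝ v w) :
    ∀ᶠ y' in nhds y, y' ⬝ᵥ v = y' ⬝ᵥ w → segment ℝ v w ⊆ maxFace P y' := by
  obtain ⟨S, hS, -, rfl⟩ := hP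
  have hv : v ∈ maxFace (convexHull ℝ S) y := h ▸ left_mem_segment ℝ v w
  have ev : ∀ s ∈ S, ∀ᶠ y' in nhds y, s ∈ segment ℝ v w ∨ y' ⬝ᵥ s < y' ⬝ᵥ v := by
    intro s hs
    by_cases hsv : s ∈ segment ℝ v w
    · exact Filter.Eventually.of_forall fun _ => Or.inl hsv
    · have hs' := subset_convexHull ℝ S hs
      have hlt : y ⬝ᵥ s < y ⬝ᵥ v := by
        refine lt_of_le_of_ne (hv.2 s hs') fun hh => hsv ?_
        rw [← h]
        exact ⟨hs', fun z hz => hh ▸ hv.2 z hz⟩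
      have c1 : Continuous fun y' : I → ℝ => y' ⬝ᵥ s := by unfold dotProduct; fun_prop
      have c2 : Continuous fun y' : I → ℝ => y' ⬝ᵥ v := by unfold dotProduct; fun_prop
      exact (c1.continuousAt.eventually_lt c2.continuousAt hlt).mono fun _ hh => Or.inr hh
  filter_upwards [(Filter.eventually_all_finite hS).2 ev] with y' hy' hvw
  have hseg : ∀ x ∈ segment ℝ v w, y' ⬝ᵥ x = y' ⬝ᵥ v := by
    rintro x ⟨a, b, -, -, hab, rfl⟩
    rw [dotProduct_add, dotProduct_smul, dotProduct_smul, ← hvw, ← add_smul, hab, one_smul]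
  have hmax : convexHull ℝ S ⊆ {z : I → ℝ | y' ⬝ᵥ z ≤ y' ⬝ᵥ v} := by
    refine convexHull_min (fun s hs => ?_) (convex_halfSpace_le
      ⟨fun a b => dotProduct_add _ _ _, fun c a => dotProduct_smul _ _ _⟩ _)
    rcases hy' s hs with h1 | h1
    · exact (hseg s h1).le
    · exact h1.le
  intro x hx
  have hxP : x ∈ maxFace (convexHull ℝ S) y := h ▸ hx
  exact ⟨hxP.1, fun z hz => (hseg x hx).symm ▸ hmax hz⟩

theorem maxFace_mono_of_fan {I : Type} [Fintype I] {P Q : Set (I → ℝ)}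
    (hPQ : normalFan P = normalFan Q) {y y' : I → ℝ} (hne : (maxFace Q y).Nonempty)
    (h : maxFace P y ⊆ maxFace P y') : maxFace Q y ⊆ maxFace Q y' := by
  have hmem : normalCone Q (maxFace Q y) ∈ normalFan Q := ⟨_, ⟨hne, y, rfl⟩, rfl⟩
  rw [← hPQ] at hmem
  obtain ⟨G, ⟨-, y0, hG⟩, hC⟩ := hmem
  have hy : y ∈ normalCone P G := hC ▸ fun x hx z hz => hx.2 z hz
  have hy' : y' ∈ normalCone P G := by
    intro x hx z hz
    have hxP : x ∈ P := by rw [hG] at hx; exact hx.1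
    exact (h ⟨hxP, hy x hx⟩).2 z hz
  rw [← hC] at hy'
  exact fun x hx => ⟨hx.1, hy' x hx⟩

theorem mem_normalCone_vertex {I : Type} [Fintype I] {P : Set (I → ℝ)} {v y : I → ℝ}
    (hv : IsVertex P v) : y ∈ normalCone P {v} ↔ v ∈ maxFace P y := by
  obtain ⟨-, y0, hy0⟩ := hv
  have hvP : v ∈ maxFace P y0 := by rw [← hy0]; rfl
  constructor
  · intro h
    exact ⟨hvP.1, h v rfl⟩
  · rintro h x rfl
    exact h.2

theorem vertex_nhds {I : Type} [Fintype I] {P : Set (I → ℝ)} (hP : IsPolytope P) {v y : I → ℝ}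
    (h : maxFace P y = {v}) : ∀ᶠ y' in nhds y, v ∈ maxFace P y' := by
  have := segment_subset_maxFace hP (h.trans (segment_same ℝ v).symm)
  filter_upwards [this] with y' hy'
  exact hy' rfl (left_mem_segment ℝ v v)

theorem eventually_pos_line {I : Type} [Fintype I] {y z : I → ℝ} {p : (I → ℝ) → Prop}
    (h : ∀ᶠ y' in nhds y, p y') : ∃ ε : ℝ, 0 < ε ∧ p (y + ε • z) := by
  have hc : Filter.Tendsto (fun ε : ℝ => y + ε • z) (nhdsWithin 0 (Set.Ioi 0)) (nhds y) := by
    have : Continuous fun ε : ℝ => y + ε • z := by fun_prop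
    have h0 := this.tendsto 0
    simp only [zero_smul, add_zero] at h0
    exact h0.mono_left nhdsWithin_le_nhds
  obtain ⟨ε, h1, h2⟩ := ((hc.eventually h).and self_mem_nhdsWithin).exists
  exact ⟨ε, h2, h1⟩

theorem exists_vertex_of_fan {I : Type} [Fintype I] {P Q : Set (I → ℝ)} (hP : IsPolytope P)
    (hPQ : normalFan P = normalFan Q) {v : I → ℝ} (hv : IsVertex P v) :
    ∃ v', IsVertex Q v' ∧ normalCone P {v} = normalCone Q {v'} := by
  have hmem : normalCone P {v} ∈ normalFan P := ⟨_, hv, rfl⟩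
  rw [hPQ] at hmem
  obtain ⟨F, hF, hC⟩ := hmem
  obtain ⟨v', hv'⟩ := hF.1
  obtain ⟨-, y, hy⟩ := id hv
  have hFQ : F ⊆ Q := by
    obtain ⟨-, y0, hy0⟩ := hF
    rw [hy0]; exact fun x hx => hx.1
  have hF' : F = {v'} := by
    refine Set.eq_singleton_iff_unique_mem.2 ⟨hv', fun x hx => ?_⟩
    have ev : ∀ᶠ y' in nhds y, y' ⬝ᵥ x = y' ⬝ᵥ v' := by
      filter_upwards [vertex_nhds hP hy.symm] with y' hy'
      rw [← mem_normalCone_vertex hv, hC] at hy'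
      exact le_antisymm (hy' v' hv' x (hFQ hx)) (hy' x hx v' (hFQ hv'))
    obtain ⟨ε, hε, h1⟩ := eventually_pos_line (z := x - v') ev
    have h0 := ev.self_of_nhds
    simp only [add_dotProduct, smul_dotProduct, smul_eq_mul, h0, add_right_inj] at h1
    have h2 := mul_left_cancel₀ hε.ne' h1
    have h3 : (x - v') ⬝ᵥ (x - v') = 0 := by rw [dotProduct_sub, h2, sub_self]
    exact sub_eq_zero.1 (dotProduct_self_eq_zero.1 h3)
  rw [hF'] at hF hC
  exact ⟨v', hF, hC⟩

theorem vertex_unique {I : Type} [Fintype I] {P : Set (I → ℝ)} {v w : I → ℝ} (hv : IsVertex P v)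
    (hw : IsVertex P w) (h : normalCone P {v} = normalCone P {w}) : v = w := by
  obtain ⟨-, y, hy⟩ := id hv
  have h1 : y ∈ normalCone P {v} := (mem_normalCone_vertex hv).2 (by rw [← hy]; rfl)
  rw [h, mem_normalCone_vertex hw, ← hy] at h1
  exact (show w = v from h1).symm

theorem isCompact_maxFace {I : Type} [Fintype I] {P : Set (I → ℝ)} (hP : IsPolytope P)
    (y : I → ℝ) : IsCompact (maxFace P y) := by
  obtain ⟨S, hS, -, rfl⟩ := hP
  have c2 : Continuous fun x : I → ℝ => y ⬝ᵥ x := by unfold dotProduct; fun_prop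
  have : maxFace (convexHull ℝ S) y =
      convexHull ℝ S ∩ ⋂ z ∈ convexHull ℝ S, {x | y ⬝ᵥ z ≤ y ⬝ᵥ x} := by
    ext x; simp [maxFace]
  rw [this]
  exact (hS.isCompact_convexHull ℝ).inter_right
    (isClosed_biInter fun z _ => isClosed_le continuous_const c2)

theorem convex_maxFace {I : Type} [Fintype I] {P : Set (I → ℝ)} (hP : IsPolytope P)
    (y : I → ℝ) : Convex ℝ (maxFace P y) := by
  obtain ⟨S, hS, -, rfl⟩ := hP
  have : maxFace (convexHull ℝ S) y =
      convexHull ℝ S ∩ ⋂ z ∈ convexHull ℝ S, {x | y ⬝ᵥ z ≤ y ⬝ᵥ x} := by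
    ext x; simp [maxFace]
  rw [this]
  exact (convex_convexHull ℝ S).inter (convex_iInter₂ fun z _ => convex_halfSpace_ge
    ⟨fun a b => dotProduct_add _ _ _, fun c a => dotProduct_smul _ _ _⟩ _)

theorem tangentCone_le_of_fan {I : Type} [Fintype I] {P Q : Set (I → ℝ)} (hP : IsPolytope P)
    (hQ : IsPolytope Q) (hPQ : normalFan P = normalFan Q) {v v' : I → ℝ} (hv : IsVertex P v)
    (hv' : IsVertex Q v') (hN : normalCone P {v} = normalCone Q {v'}) :
    tangentCone P v ≤ tangentCone Q v' := by
  refine Submodule.span_le.2 ?_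
  rintro _ ⟨w, ⟨hne, hse, y, hy⟩, rfl⟩
  have hvy : v ∈ maxFace P y := hy ▸ left_mem_segment ℝ v w
  have hwy : w ∈ maxFace P y := hy ▸ right_mem_segment ℝ v w
  have hv'y : v' ∈ maxFace Q y := by
    rwa [← mem_normalCone_vertex hv', ← hN, mem_normalCone_vertex hv]
  have hyvw : y ⬝ᵥ v = y ⬝ᵥ w := le_antisymm (hwy.2 v hvy.1) (hvy.2 w hwy.1)
  set d : I → ℝ := w - v with hd
  have hd0 : d ⬝ᵥ d ≠ 0 := fun h => hne (sub_eq_zero.1 (dotProduct_self_eq_zero.1 h)).symm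
  have hdpos : 0 < d ⬝ᵥ d :=
    lt_of_le_of_ne (Finset.sum_nonneg fun i _ => mul_self_nonneg (d i)) hd0.symm
  -- every point of the corresponding face of `Q` lies on the ray from `v'` in direction `d`
  have claim1 : ∀ x ∈ maxFace Q y, ∃ c : ℝ, 0 ≤ c ∧ x - v' = c • d := by
    intro x hx
    have perp : ∀ z : I → ℝ, z ⬝ᵥ d = 0 → z ⬝ᵥ (x - v') = 0 := by
      intro z hz
      obtain ⟨ε, hε, h1⟩ := eventually_pos_line (z := z) (segment_subset_maxFace hP hy.symm)
      have hzz : z ⬝ᵥ v = z ⬝ᵥ w := by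
        rw [hd, dotProduct_sub] at hz; linarith
      have h2 := h1 (by simp only [add_dotProduct, smul_dotProduct, hyvw, hzz])
      rw [hy] at h2
      have h3 := maxFace_mono_of_fan hPQ ⟨v', hv'y⟩ h2
      have h4 := (h3 hx).2 v' hv'y.1
      have h5 := (h3 hv'y).2 x hx.1
      have h6 := hx.2 v' hv'y.1
      have h7 := hv'y.2 x hx.1
      simp only [add_dotProduct, smul_dotProduct, smul_eq_mul] at h4 h5
      rw [dotProduct_sub]
      have h8 : ε * (z ⬝ᵥ x - z ⬝ᵥ v') = 0 := by linarith
      exact (mul_eq_zero.1 h8).resolve_left hε.ne'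
    let c : ℝ := ((x - v') ⬝ᵥ d) / (d ⬝ᵥ d)
    have hz : ((x - v') - c • d) ⬝ᵥ d = 0 := by
      rw [sub_dotProduct, smul_dotProduct, smul_eq_mul, div_mul_cancel₀ _ hd0, sub_self]
    have hx' : x - v' = c • d := by
      refine sub_eq_zero.1 (dotProduct_self_eq_zero.1 ?_)
      rw [dotProduct_sub, perp _ hz, dotProduct_smul, hz, smul_zero, sub_zero]
    refine ⟨c, ?_, hx'⟩
    obtain ⟨-, y0, hy0⟩ := id hv
    have hv0 : v ∈ maxFace P y0 := by rw [← hy0]; rfl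
    have hlt : y0 ⬝ᵥ d < 0 := by
      rw [hd, dotProduct_sub, sub_neg]
      refine lt_of_le_of_ne (hv0.2 w hwy.1) fun h => hne ?_
      have : w ∈ maxFace P y0 := ⟨hwy.1, fun z hz => h ▸ hv0.2 z hz⟩
      rw [← hy0] at this
      exact (show w = v from this).symm
    have hv'0 : v' ∈ maxFace Q y0 := by
      rwa [← mem_normalCone_vertex hv', ← hN, mem_normalCone_vertex hv]
    have h1 := hv'0.2 x hx.1
    have h2 : y0 ⬝ᵥ (x - v') ≤ 0 := by rw [dotProduct_sub]; linarith
    rw [hx', dotProduct_smul, smul_eq_mul] at h2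
    by_contra hc
    nlinarith [mul_pos_of_neg_of_neg (not_le.1 hc) hlt]
  -- this face is not reduced to `v'`
  have claim2 : ∃ x ∈ maxFace Q y, x ≠ v' := by
    by_contra hall
    push Not at hall
    have h1 : maxFace Q y = {v'} := Set.eq_singleton_iff_unique_mem.2 ⟨hv'y, hall⟩
    obtain ⟨ε, hε, h2⟩ := eventually_pos_line (z := d) (vertex_nhds hQ h1)
    rw [← mem_normalCone_vertex hv', ← hN, mem_normalCone_vertex hv] at h2
    have h3 := h2.2 w hwy.1
    simp only [add_dotProduct, smul_dotProduct, smul_eq_mul, hyvw] at h3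
    have h4 : ε * (d ⬝ᵥ d) ≤ 0 := by
      have : d ⬝ᵥ d = d ⬝ᵥ w - d ⬝ᵥ v := by rw [← dotProduct_sub]
      rw [this, mul_sub]; linarith
    nlinarith [mul_pos hε hdpos]
  have c2 : Continuous fun x : I → ℝ => d ⬝ᵥ x := by unfold dotProduct; fun_prop
  obtain ⟨w', hw', hmax⟩ := (isCompact_maxFace hQ y).exists_isMaxOn ⟨v', hv'y⟩ c2.continuousOn
  obtain ⟨c', hc'0, hc'⟩ := claim1 w' hw'
  have hle : ∀ x ∈ maxFace Q y, ∀ c : ℝ, x - v' = c • d → c ≤ c' := by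
    intro x hx c hc
    have h1 : d ⬝ᵥ x ≤ d ⬝ᵥ w' := hmax hx
    have h2 : d ⬝ᵥ (x - v') ≤ d ⬝ᵥ (w' - v') := by
      rw [dotProduct_sub, dotProduct_sub]; linarith
    rw [hc, hc', dotProduct_smul, dotProduct_smul, smul_eq_mul, smul_eq_mul] at h2
    exact le_of_mul_le_mul_right h2 hdpos
  have hc'pos : 0 < c' := by
    obtain ⟨x, hx, hxne⟩ := claim2
    obtain ⟨c, hc0, hc⟩ := claim1 x hx
    refine lt_of_lt_of_le (lt_of_le_of_ne hc0 fun h => hxne ?_) (hle x hx c hc)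
    rw [← h, zero_smul] at hc
    exact sub_eq_zero.1 hc
  have hedge : IsEdge Q v' w' := by
    refine ⟨fun h => ?_, ⟨v', left_mem_segment ℝ v' w'⟩, y, ?_⟩
    · rw [← h, sub_self] at hc'
      rcases smul_eq_zero.1 hc'.symm with h1 | h1
      · exact hc'pos.ne' h1
      · exact hd0 (by rw [h1, dotProduct_zero])
    · refine Set.Subset.antisymm ((convex_maxFace hQ y).segment_subset hv'y hw') fun x hx => ?_
      obtain ⟨c, hc0, hc⟩ := claim1 x hx
      rw [segment_eq_image']
      refine ⟨c / c', ⟨div_nonneg hc0 hc'0, (div_le_one hc'pos).2 (hle x hx c hc)⟩, ?_⟩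
      simp only
      rw [hc', smul_smul, div_mul_cancel₀ _ hc'pos.ne', ← hc]
      abel
  have hmem : w' - v' ∈ tangentCone Q v' := Submodule.subset_span ⟨w', hedge, rfl⟩
  have : d = (⟨c'⁻¹, inv_nonneg.2 hc'0⟩ : {c : ℝ // 0 ≤ c}) • (w' - v') := by
    change d = c'⁻¹ • (w' - v')
    rw [hc', smul_smul, inv_mul_cancel₀ hc'pos.ne', one_smul]
  rw [this]
  exact Submodule.smul_mem _ _ hmem

theorem tangentCone_eq_of_fan {I : Type} [Fintype I] {P Q : Set (I → ℝ)} (hP : IsPolytope P)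
    (hQ : IsPolytope Q) (hPQ : normalFan P = normalFan Q) {v v' : I → ℝ} (hv : IsVertex P v)
    (hv' : IsVertex Q v') (hN : normalCone P {v} = normalCone Q {v'}) :
    tangentCone P v = tangentCone Q v' :=
  le_antisymm (tangentCone_le_of_fan hP hQ hPQ hv hv' hN)
    (tangentCone_le_of_fan hQ hP hPQ.symm hv' hv hN.symm)

theorem vertexPoset_congr {I : Type} [Fintype I] {P Q : Set (I → ℝ)} {v v' : I → ℝ}
    (hv : IsVertex P v) (hv' : IsVertex Q v') (h : tangentCone P v = tangentCone Q v') :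
    vertexPoset P v hv = vertexPoset Q v' hv' := by
  refine PartialOrder.ext fun j i => ?_
  change _ ∈ tangentCone P v ↔ _ ∈ tangentCone Q v'
  rw [h]

/-! ### Relabelling -/

/-- The image of `P ⊆ ℝI` under the relabelling `ℝI ≃ ℝJ`, `e_i ↦ e_{σ(i)}`. -/
def relabel {I J : Type} (σ : I ≃ J) (P : Set (I → ℝ)) : Set (J → ℝ) :=
  {x | x ∘ σ ∈ P}

theorem relabel_eq_image {I J : Type} (σ : I ≃ J) (P : Set (I → ℝ)) :
    relabel σ P = (LinearMap.funLeft ℝ ℝ σ.symm) '' P := by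
  ext x
  constructor
  · intro h
    exact ⟨x ∘ σ, h, by ext j; simp [LinearMap.funLeft_apply]⟩
  · rintro ⟨z, hz, rfl⟩
    have : (LinearMap.funLeft ℝ ℝ σ.symm z) ∘ σ = z := by ext i; simp [LinearMap.funLeft_apply]
    rw [relabel, Set.mem_ofPred_eq, this]
    exact hz

theorem relabel_symm_relabel {I J : Type} (σ : I ≃ J) (P : Set (I → ℝ)) :
    relabel σ.symm (relabel σ P) = P := by
  ext x; simp [relabel, Function.comp_assoc]

theorem relabel_relabel_symm {I J : Type} (σ : I ≃ J) (P : Set (J → ℝ)) :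
    relabel σ (relabel σ.symm P) = P := by
  ext x; simp [relabel, Function.comp_assoc]

theorem dot_comp {I J : Type} [Fintype I] [Fintype J] (σ : I ≃ J) (y x : J → ℝ) :
    y ⬝ᵥ x = (y ∘ σ) ⬝ᵥ (x ∘ σ) :=
  (comp_equiv_dotProduct_comp_equiv y x σ).symm

theorem relabel_forall {I J : Type} (σ : I ≃ J) (P : Set (I → ℝ)) (p : (I → ℝ) → Prop) :
    (∀ z ∈ relabel σ P, p (z ∘ σ)) ↔ ∀ z ∈ P, p z := by
  constructor
  · intro h z hz
    have e : (z ∘ σ.symm) ∘ σ = z := by ext i; simp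
    have := h (z ∘ σ.symm) (by rw [relabel, Set.mem_ofPred_eq, e]; exact hz)
    rwa [e] at this
  · intro h z hz
    exact h _ hz

theorem maxFace_relabel {I J : Type} [Fintype I] [Fintype J] (σ : I ≃ J) (P : Set (I → ℝ))
    (y : J → ℝ) : maxFace (relabel σ P) y = relabel σ (maxFace P (y ∘ σ)) := by
  ext x
  simp only [maxFace, Set.mem_ofPred_eq, relabel]
  refine and_congr_right fun _ => ?_
  simp only [dot_comp σ y]
  exact relabel_forall σ P fun z => (y ∘ σ) ⬝ᵥ z ≤ (y ∘ σ) ⬝ᵥ (x ∘ σ)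

theorem normalCone_relabel {I J : Type} [Fintype I] [Fintype J] (σ : I ≃ J)
    (P F : Set (I → ℝ)) :
    normalCone (relabel σ P) (relabel σ F) = relabel σ (normalCone P F) := by
  ext y
  have h : ∀ x, (∀ z ∈ relabel σ P, (y ∘ σ) ⬝ᵥ (z ∘ σ) ≤ (y ∘ σ) ⬝ᵥ x) ↔
      ∀ z ∈ P, (y ∘ σ) ⬝ᵥ z ≤ (y ∘ σ) ⬝ᵥ x :=
    fun x => relabel_forall σ P fun z => (y ∘ σ) ⬝ᵥ z ≤ (y ∘ σ) ⬝ᵥ x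
  simp only [normalCone, Set.mem_ofPred_eq]
  simp only [dot_comp σ y, h]
  exact relabel_forall σ F fun x => ∀ z ∈ P, (y ∘ σ) ⬝ᵥ z ≤ (y ∘ σ) ⬝ᵥ x

theorem IsFace.relabel {I J : Type} [Fintype I] [Fintype J] (σ : I ≃ J) {P F : Set (I → ℝ)}
    (h : IsFace P F) : IsFace (relabel σ P) (relabel σ F) := by
  obtain ⟨hne, y, rfl⟩ := h
  refine ⟨?_, y ∘ σ.symm, ?_⟩
  · rw [relabel_eq_image]; exact hne.image _
  · rw [maxFace_relabel]
    congr
    ext i; simp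

theorem mem_normalFan_relabel {I J : Type} [Fintype I] [Fintype J] (σ : I ≃ J)
    {P C : Set (I → ℝ)} (h : C ∈ normalFan P) : relabel σ C ∈ normalFan (relabel σ P) := by
  obtain ⟨F, hF, rfl⟩ := h
  exact ⟨_, hF.relabel σ, (normalCone_relabel σ P F).symm⟩

theorem normalFan_relabel {I J : Type} [Fintype I] [Fintype J] (σ : I ≃ J)
    (P : Set (I → ℝ)) : normalFan (relabel σ P) = relabel σ '' normalFan P := by
  ext C
  constructor
  · intro h
    have := mem_normalFan_relabel σ.symm h
    rw [relabel_symm_relabel] at this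
    exact ⟨_, this, relabel_relabel_symm σ C⟩
  · rintro ⟨D, hD, rfl⟩
    exact mem_normalFan_relabel σ hD

theorem IsPolytope.relabel {I J : Type} (σ : I ≃ J) {P : Set (I → ℝ)} (h : IsPolytope P) :
    IsPolytope (relabel σ P) := by
  obtain ⟨S, hS, hne, rfl⟩ := h
  refine ⟨(LinearMap.funLeft ℝ ℝ σ.symm) '' S, hS.image _, hne.image _, ?_⟩
  rw [relabel_eq_image, LinearMap.image_convexHull]

theorem relabel_permutahedron {I J : Type} [Fintype I] [Fintype J] (σ : I ≃ J) :
    relabel σ (permutahedron I) = permutahedron J := by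
  have hc : Fintype.card I = Fintype.card J := Fintype.card_congr σ
  rw [permutahedron, permutahedron, relabel_eq_image, LinearMap.image_convexHull,
    ← relabel_eq_image]
  congr 1
  ext x
  constructor
  · rintro ⟨f, hf⟩
    refine ⟨(σ.symm.trans f).trans (finCongr hc), fun j => ?_⟩
    have := hf (σ.symm j)
    simpa using this
  · rintro ⟨f, hf⟩
    refine ⟨(σ.trans f).trans (finCongr hc.symm), fun i => ?_⟩
    have := hf (σ i)
    simpa using this

/-- Relabelling of generalized permutahedra. -/
def GenPerm.map {I J : Type} [Fintype I] [Fintype J] (σ : I ≃ J) (P : GenPerm I) : GenPerm J where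
  carrier := relabel σ P.carrier
  isPolytope := P.isPolytope.relabel σ
  coarsens := by
    rw [← relabel_permutahedron σ, normalFan_relabel, normalFan_relabel]
    rintro _ ⟨C, hC, rfl⟩
    obtain ⟨D, hD, hCD⟩ := P.coarsens C hC
    exact ⟨_, ⟨D, hD, rfl⟩, fun x hx => hCD hx⟩

/-- Relabelling of posets: `σ(i) ≤ σ(j)` in the new poset if and only if `i ≤ j` in `p`. -/
@[reducible] def posetRelabel {I J : Type} (σ : I ≃ J) (p : PartialOrder I) : PartialOrder J :=
  @PartialOrder.lift J I p σ.symm σ.symm.injective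

theorem relabel_singleton {I J : Type} (σ : I ≃ J) (v : J → ℝ) :
    relabel σ {v ∘ σ} = {v} := by
  ext x
  simp only [relabel, Set.mem_ofPred_eq, Set.mem_singleton_iff]
  exact ⟨fun h => σ.surjective.injective_comp_right h, fun h => by rw [h]⟩

theorem relabel_segment {I J : Type} (σ : I ≃ J) (v w : J → ℝ) :
    relabel σ (segment ℝ (v ∘ σ) (w ∘ σ)) = segment ℝ v w := by
  have e : ∀ v : J → ℝ, LinearMap.funLeft ℝ ℝ σ.symm (v ∘ σ) = v := fun v => by
    ext j; simp [LinearMap.funLeft_apply]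
  rw [relabel_eq_image, ← LinearMap.coe_toAffineMap, image_segment]
  simp only [LinearMap.coe_toAffineMap, e]

theorem IsVertex.of_relabel {I J : Type} [Fintype I] [Fintype J] (σ : I ≃ J) {P : Set (I → ℝ)}
    {v : J → ℝ} (h : IsVertex (relabel σ P) v) : IsVertex P (v ∘ σ) := by
  have := IsFace.relabel σ.symm h
  rw [relabel_symm_relabel] at this
  have e : relabel σ.symm {v} = {v ∘ σ} := by
    rw [← relabel_singleton σ v, relabel_symm_relabel]
  rwa [e] at this

theorem IsVertex.relabel {I J : Type} [Fintype I] [Fintype J] (σ : I ≃ J) {P : Set (I → ℝ)}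
    {v : J → ℝ} (h : IsVertex P (v ∘ σ)) : IsVertex (relabel σ P) v := by
  have := IsFace.relabel σ h
  rwa [relabel_singleton] at this

theorem IsEdge.of_relabel {I J : Type} [Fintype I] [Fintype J] (σ : I ≃ J) {P : Set (I → ℝ)}
    {v w : J → ℝ} (h : IsEdge (BrionMap.relabel σ P) v w) : IsEdge P (v ∘ σ) (w ∘ σ) := by
  refine ⟨fun e => h.1 (σ.surjective.injective_comp_right e), ?_⟩
  have := IsFace.relabel σ.symm h.2
  rw [relabel_symm_relabel] at this
  have e : BrionMap.relabel σ.symm (segment ℝ v w) = segment ℝ (v ∘ σ) (w ∘ σ) := by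
    rw [← relabel_segment σ v w, relabel_symm_relabel]
  rwa [e] at this

theorem mem_tangentCone_relabel_aux {I J : Type} [Fintype I] [Fintype J] (σ : I ≃ J)
    {P : Set (I → ℝ)} {v d : J → ℝ} (h : d ∈ tangentCone (relabel σ P) v) :
    d ∘ σ ∈ tangentCone P (v ∘ σ) := by
  induction h using Submodule.span_induction with
  | mem x hx =>
    obtain ⟨w, hw, rfl⟩ := hx
    exact Submodule.subset_span ⟨w ∘ σ, hw.of_relabel σ, rfl⟩
  | zero => exact Submodule.zero_mem _
  | add x z _ _ hx hz => exact Submodule.add_mem _ hx hz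
  | smul a x _ hx => exact Submodule.smul_mem _ a hx

theorem mem_tangentCone_relabel {I J : Type} [Fintype I] [Fintype J] (σ : I ≃ J)
    {P : Set (I → ℝ)} {v d : J → ℝ} :
    d ∈ tangentCone (relabel σ P) v ↔ d ∘ σ ∈ tangentCone P (v ∘ σ) := by
  refine ⟨mem_tangentCone_relabel_aux σ, fun h => ?_⟩
  rw [← relabel_symm_relabel σ P] at h
  have := mem_tangentCone_relabel_aux σ.symm h
  simpa [Function.comp_assoc] using this

theorem stdVec_comp {I J : Type} (σ : I ≃ J) (j : J) :
    (stdVec j : J → ℝ) ∘ σ = stdVec (σ.symm j) := by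
  ext i
  simp only [stdVec, Function.comp_apply, Pi.single_apply]
  by_cases h : σ i = j
  · rw [if_pos h, if_pos (by rw [← h, Equiv.symm_apply_apply])]
  · rw [if_neg h, if_neg fun h' => h (by rw [h', Equiv.apply_symm_apply])]

theorem vertexPoset_relabel {I J : Type} [Fintype I] [Fintype J] (σ : I ≃ J) {P : Set (I → ℝ)}
    {v : J → ℝ} (hv : IsVertex (relabel σ P) v) :
    vertexPoset (relabel σ P) v hv =
      posetRelabel σ (vertexPoset P (v ∘ σ) (hv.of_relabel σ)) := by
  refine PartialOrder.ext fun j i => ?_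
  change stdVec i - stdVec j ∈ tangentCone (relabel σ P) v ↔
    stdVec (σ.symm i) - stdVec (σ.symm j) ∈ tangentCone P (v ∘ σ)
  rw [mem_tangentCone_relabel, ← stdVec_comp, ← stdVec_comp]
  rfl

/-! ### Vector species and the Fock functor -/

/-- A vector species over `K`. -/
structure VectorSpecies (K : Type u) [Field K] where
  obj : (I : Type) → [Fintype I] → Type u
  [addCommGroup : (I : Type) → [Fintype I] → AddCommGroup (obj I)]
  [module : (I : Type) → [Fintype I] → Module K (obj I)]
  map : {I J : Type} → [Fintype I] → [Fintype J] → (I ≃ J) → (obj I →ₗ[K] obj J)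
  map_refl : ∀ (I : Type) [Fintype I], map (Equiv.refl I) = LinearMap.id
  map_trans : ∀ {I J L : Type} [Fintype I] [Fintype J] [Fintype L] (σ : I ≃ J) (τ : J ≃ L),
    map (σ.trans τ) = map τ ∘ₗ map σ

attribute [instance] VectorSpecies.addCommGroup VectorSpecies.module

/-- A morphism of vector species. -/
structure SpeciesHom {K : Type u} [Field K] (F G : VectorSpecies K) where
  app : (I : Type) → [Fintype I] → (F.obj I →ₗ[K] G.obj I)
  naturality : ∀ {I J : Type} [Fintype I] [Fintype J] (σ : I ≃ J),
    app J ∘ₗ F.map σ = G.map σ ∘ₗ app I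

/-- The composition of morphisms of vector species. -/
def SpeciesHom.comp {K : Type u} [Field K] {F G H : VectorSpecies K} (g : SpeciesHom G H)
    (f : SpeciesHom F G) : SpeciesHom F H where
  app I _ := g.app I ∘ₗ f.app I
  naturality σ := by
    rw [LinearMap.comp_assoc, f.naturality, ← LinearMap.comp_assoc, g.naturality,
      LinearMap.comp_assoc]

/-- The subspace of `F[n]` spanned by the differences between an element and its relabellings. -/
def fockKer {K : Type u} [Field K] (F : VectorSpecies K) (n : ℕ) : Submodule K (F.obj (Fin n)) :=
  Submodule.span K {z | ∃ (σ : Fin n ≃ Fin n) (x : F.obj (Fin n)), z = F.map σ x - x}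

/-- The underlying vector space `⨁ n, F[n]_{S_n}` of the image of `F` under the Fock functor,
where `F[n]_{S_n}` is the space of coinvariants. -/
abbrev Fock {K : Type u} [Field K] (F : VectorSpecies K) : Type u :=
  DirectSum ℕ fun n => F.obj (Fin n) ⧸ fockKer F n

/-- The class in `Fock F` of an element of `F[n]`. -/
def fockMk {K : Type u} [Field K] (F : VectorSpecies K) (n : ℕ) : F.obj (Fin n) →ₗ[K] Fock F :=
  DirectSum.lof K ℕ (fun n => F.obj (Fin n) ⧸ fockKer F n) n ∘ₗ (fockKer F n).mkQ

theorem fockKer_le {K : Type u} [Field K] {F G : VectorSpecies K} (f : SpeciesHom F G) (n : ℕ) :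
    fockKer F n ≤ (fockKer G n).comap (f.app (Fin n)) := by
  refine Submodule.span_le.2 ?_
  rintro _ ⟨σ, x, rfl⟩
  refine Submodule.subset_span ⟨σ, f.app (Fin n) x, ?_⟩
  rw [map_sub]
  congr 1
  exact LinearMap.congr_fun (f.naturality σ) x

/-- The linear map induced by a morphism of species under the Fock functor. -/
def fockMap {K : Type u} [Field K] {F G : VectorSpecies K} (f : SpeciesHom F G) :
    Fock F →ₗ[K] Fock G :=
  DirectSum.lmap fun n => (fockKer F n).mapQ (fockKer G n) (f.app (Fin n)) (fockKer_le f n)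

theorem fockMk_map {K : Type u} [Field K] (F : VectorSpecies K) (n : ℕ) (σ : Fin n ≃ Fin n)
    (x : F.obj (Fin n)) : fockMk F n (F.map σ x) = fockMk F n x := by
  have : (fockKer F n).mkQ (F.map σ x) = (fockKer F n).mkQ x :=
    (Submodule.Quotient.eq _).2 (Submodule.subset_span ⟨σ, x, rfl⟩)
  simp only [fockMk, LinearMap.comp_apply, this]

/-! ### The species of posets and of generalized permutahedra up to normal equivalence -/

/-- The species of posets: `P[I]` has a basis indexed by the partial orders on `I`. -/
noncomputable def posetSpecies (K : Type u) [Field K] : VectorSpecies K where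
  obj I _ := PartialOrder I →₀ K
  map σ := Finsupp.lmapDomain K K (posetRelabel σ)
  map_refl I _ := by
    have : (posetRelabel (Equiv.refl I)) = id := by
      funext p; exact PartialOrder.ext fun x y => Iff.rfl
    rw [this, Finsupp.lmapDomain_id]
  map_trans σ τ := by
    rw [← Finsupp.lmapDomain_comp]
    rfl

/-- Normal equivalence of generalized permutahedra: having the same normal fan. -/
instance normalEquiv (I : Type) [Fintype I] : Setoid (GenPerm I) where
  r P Q := normalFan P.carrier = normalFan Q.carrier
  iseqv := ⟨fun _ => rfl, fun h => h.symm, fun h h' => h.trans h'⟩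

/-- Normal equivalence classes of generalized permutahedra in `ℝI`. -/
def GPBar (I : Type) [Fintype I] : Type := Quotient (normalEquiv I)

/-- Relabelling of normal equivalence classes. -/
def GPBar.map {I J : Type} [Fintype I] [Fintype J] (σ : I ≃ J) : GPBar I → GPBar J :=
  Quotient.map (GenPerm.map σ) fun P Q h => by
    change normalFan (relabel σ P.carrier) = normalFan (relabel σ Q.carrier)
    rw [normalFan_relabel, normalFan_relabel, show normalFan P.carrier = normalFan Q.carrier from h]

/-- The species of generalized permutahedra up to normal equivalence. -/
noncomputable def gpSpecies (K : Type u) [Field K] : VectorSpecies K where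
  obj I _ := GPBar I →₀ K
  map σ := Finsupp.lmapDomain K K (GPBar.map σ)
  map_refl I _ := by
    have : (GPBar.map (Equiv.refl I)) = id := by
      funext c
      induction c using Quotient.inductionOn with
      | h P => rfl
    rw [this, Finsupp.lmapDomain_id]
  map_trans σ τ := by
    rw [← Finsupp.lmapDomain_comp]
    congr 1
    funext c
    induction c using Quotient.inductionOn with
    | h P => rfl

/-! ### The Brion map -/

/-- The set of vertices of a generalized permutahedron. -/
def GenPerm.vertices {I : Type} [Fintype I] (P : GenPerm I) : Set (I → ℝ) :=
  {v | IsVertex P.carrier v}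

noncomputable instance fintypeVertices {I : Type} [Fintype I] (P : GenPerm I) :
    Fintype P.vertices :=
  (finite_isVertex P.isPolytope).fintype

/-- `B(P) = ∑ poset_v(P)`, the sum over the vertices `v` of `P`. -/
noncomputable def brionSum (K : Type u) [Field K] {I : Type} [Fintype I] (P : GenPerm I) :
    PartialOrder I →₀ K :=
  ∑ v : P.vertices, Finsupp.single (vertexPoset P.carrier v.1 v.2) 1

theorem brionSum_congr (K : Type u) [Field K] {I : Type} [Fintype I] {P Q : GenPerm I}
    (h : normalFan P.carrier = normalFan Q.carrier) : brionSum K P = brionSum K Q := by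
  choose f hf hfN using fun v : P.vertices => exists_vertex_of_fan P.isPolytope h v.2
  refine Fintype.sum_bijective (fun v => (⟨f v, hf v⟩ : Q.vertices)) ⟨fun v w hvw => ?_, fun w => ?_⟩
    _ _ fun v => ?_
  · refine Subtype.ext (vertex_unique v.2 w.2 ?_)
    rw [hfN v, hfN w, show f v = f w from congrArg Subtype.val hvw]
  · obtain ⟨v, hv, hvN⟩ := exists_vertex_of_fan Q.isPolytope h.symm w.2
    refine ⟨⟨v, hv⟩, Subtype.ext (vertex_unique (hf ⟨v, hv⟩) w.2 ?_)⟩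
    rw [← hfN ⟨v, hv⟩, hvN]
  · rw [vertexPoset_congr v.2 (hf v)
      (tangentCone_eq_of_fan P.isPolytope Q.isPolytope h v.2 (hf v) (hfN v))]

theorem brionSum_map (K : Type u) [Field K] {I J : Type} [Fintype I] [Fintype J] (σ : I ≃ J)
    (P : GenPerm I) :
    brionSum K (P.map σ) = Finsupp.lmapDomain K K (posetRelabel σ) (brionSum K P) := by
  rw [brionSum, brionSum, map_sum]
  refine Fintype.sum_bijective
    (fun v : (P.map σ).vertices => (⟨v.1 ∘ σ, IsVertex.of_relabel σ v.2⟩ : P.vertices))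
    ⟨fun v w hvw => ?_, fun w => ?_⟩ _ _ fun v => ?_
  · exact Subtype.ext (σ.surjective.injective_comp_right (congrArg Subtype.val hvw))
  · have e : (w.1 ∘ σ.symm) ∘ σ = w.1 := by ext i; simp
    refine ⟨⟨w.1 ∘ σ.symm, IsVertex.relabel σ ?_⟩, Subtype.ext e⟩
    rw [e]; exact w.2
  · rw [Finsupp.lmapDomain_apply, Finsupp.mapDomain_single]
    congr 1
    exact vertexPoset_relabel σ v.2

/-- `B(P)` as a function of the normal equivalence class of `P`. -/
noncomputable def brionClass (K : Type u) [Field K] {I : Type} [Fintype I] :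
    GPBar I → (PartialOrder I →₀ K) :=
  Quotient.lift (brionSum K) fun _ _ h => brionSum_congr K h

theorem brionClass_naturality (K : Type u) [Field K] {I J : Type} [Fintype I] [Fintype J]
    (σ : I ≃ J) :
    Finsupp.linearCombination K (brionClass K (I := J)) ∘ₗ Finsupp.lmapDomain K K (GPBar.map σ) =
      Finsupp.lmapDomain K K (posetRelabel σ) ∘ₗ
        Finsupp.linearCombination K (brionClass K (I := I)) := by
  refine Finsupp.lhom_ext' fun c => LinearMap.ext_ring ?_
  simp only [LinearMap.comp_apply, Finsupp.lsingle_apply, Finsupp.lmapDomain_apply,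
    Finsupp.mapDomain_single, Finsupp.linearCombination_single, one_smul]
  induction c using Quotient.inductionOn with
  | h P => exact brionSum_map K σ P

/-- The Brion map from generalized permutahedra up to normal equivalence to posets, as a morphism
of species. -/
noncomputable def brion (K : Type u) [Field K] : SpeciesHom (gpSpecies K) (posetSpecies K) where
  app I _ := Finsupp.linearCombination K (brionClass K (I := I))
  naturality σ := brionClass_naturality K σ

/-! ### Associahedra -/

/-- The simplex `Δ_A = conv{e_k : k ∈ A}`. -/
noncomputable def simplex {I : Type} (A : Set I) : Set (I → ℝ) :=
  convexHull ℝ (stdVec '' A)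

/-- The Loday associahedron of a finite linearly ordered set `I`: the Minkowski sum of the
simplices `Δ_{[i,j]}` over all `i ≤ j`. -/
noncomputable def associahedron (I : Type) [Fintype I] [LinearOrder I] : Set (I → ℝ) :=
  ∑ p : {p : I × I // p.1 ≤ p.2}, simplex (Set.Icc p.1.1 p.1.2)

theorem isPolytope_sum_simplex {I ι : Type} [Fintype I] [Fintype ι] (A : ι → Set I)
    (hA : ∀ a, (A a).Nonempty) : IsPolytope (∑ a, simplex (A a)) := by
  refine ⟨∑ a, stdVec '' (A a), ?_, ?_, ?_⟩
  · classical
    refine Finset.sum_induction _ Set.Finite (fun _ _ h h' => h.add h') Set.finite_zero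
      fun a _ => (Set.toFinite (A a)).image _
  · refine Finset.sum_induction _ Set.Nonempty (fun _ _ h h' => h.add h') Set.zero_nonempty
      fun a _ => (hA a).image _
  · rw [convexHull_sum]; rfl

theorem dot_le_of_mem_sum_simplex {I ι : Type} [Fintype I] [Fintype ι] {A : ι → Set I}
    {k : ι → I} {y : I → ℝ} (h : ∀ a, ∀ i ∈ A a, y i ≤ y (k a)) {x : I → ℝ}
    (hx : x ∈ ∑ a, simplex (A a)) : y ⬝ᵥ x ≤ y ⬝ᵥ ∑ a, stdVec (k a) := by
  obtain ⟨g, hg, rfl⟩ := (Set.mem_fintype_sum _ _).1 hx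
  rw [dotProduct_sum, dotProduct_sum]
  refine Finset.sum_le_sum fun a _ => ?_
  have : simplex (A a) ⊆ {z : I → ℝ | y ⬝ᵥ z ≤ y ⬝ᵥ stdVec (k a)} := by
    refine convexHull_min ?_ (convex_halfSpace_le
      ⟨fun a b => dotProduct_add _ _ _, fun c a => dotProduct_smul _ _ _⟩ _)
    rintro _ ⟨i, hi, rfl⟩
    change y ⬝ᵥ stdVec i ≤ y ⬝ᵥ stdVec (k a)
    rw [dot_stdVec, dot_stdVec]
    exact h a i hi
  exact this (hg a)

/-- Every cone of the braid fan consists of functionals ordered by a common bijection `f`. -/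
theorem exists_order_of_braid {I : Type} [Fintype I] {C : Set (I → ℝ)}
    (hC : C ∈ normalFan (permutahedron I)) : ∃ f : I → ℕ, Function.Injective f ∧
      ∀ y ∈ C, ∀ i j, f i < f j → y i ≤ y j := by
  classical
  obtain ⟨F, ⟨-, y0, rfl⟩, rfl⟩ := hC
  let pt : (I ≃ Fin (Fintype.card I)) → I → ℝ := fun f i => ((f i : ℕ) : ℝ) + 1
  have hpt : ∀ f, pt f ∈ permutahedron I := fun f => subset_convexHull ℝ _ ⟨f, fun _ => rfl⟩
  have : Nonempty (I ≃ Fin (Fintype.card I)) := ⟨Fintype.equivFin I⟩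
  obtain ⟨f, hf⟩ := Finite.exists_max fun f => y0 ⬝ᵥ pt f
  have hfF : pt f ∈ maxFace (permutahedron I) y0 := by
    refine ⟨hpt f, fun z hz => ?_⟩
    have : permutahedron I ⊆ {z : I → ℝ | y0 ⬝ᵥ z ≤ y0 ⬝ᵥ pt f} := by
      refine convexHull_min ?_ (convex_halfSpace_le
        ⟨fun a b => dotProduct_add _ _ _, fun c a => dotProduct_smul _ _ _⟩ _)
      rintro x ⟨g, hg⟩
      have : x = pt g := funext hg
      rw [this]
      exact hf g
    exact this hz
  refine ⟨fun i => f i, fun i j h => f.injective (Fin.ext h), fun y hy i j hij => ?_⟩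
  have h1 := hy _ hfF _ (hpt ((Equiv.swap i j).trans f))
  have h2 : pt ((Equiv.swap i j).trans f) =
      pt f + (((f j : ℕ) : ℝ) - ((f i : ℕ) : ℝ)) • (stdVec i - stdVec j) := by
    have hne : i ≠ j := by rintro rfl; exact lt_irrefl _ hij
    ext k
    simp only [pt, Equiv.trans_apply, Pi.add_apply, Pi.smul_apply, Pi.sub_apply, stdVec,
      Pi.single_apply, smul_eq_mul]
    by_cases hki : k = i
    · subst hki; simp [hne]; ring
    · by_cases hkj : k = j
      · subst hkj; simp [hki]; ring
      · simp [hki, hkj, Equiv.swap_apply_of_ne_of_ne]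
  rw [h2, dotProduct_add, dotProduct_smul, dotProduct_sub, dot_stdVec, dot_stdVec,
    smul_eq_mul] at h1
  have h3 : (0 : ℝ) < ((f j : ℕ) : ℝ) - ((f i : ℕ) : ℝ) := by
    rw [sub_pos]; exact_mod_cast hij
  nlinarith

theorem isCoarsening_sum_simplex {I ι : Type} [Fintype I] [Fintype ι] (A : ι → Set I)
    (hA : ∀ a, (A a).Nonempty) :
    IsCoarsening (normalFan (∑ a, simplex (A a))) (normalFan (permutahedron I)) := by
  intro C hC
  obtain ⟨f, hfinj, hf⟩ := exists_order_of_braid hC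
  choose k hkA hk using fun a => Set.exists_max_image (A a) f (Set.toFinite _) (hA a)
  have hpQ : ∑ a, stdVec (k a) ∈ ∑ a, simplex (A a) :=
    (Set.mem_fintype_sum _ _).2 ⟨fun a => stdVec (k a),
      fun a => subset_convexHull ℝ _ ⟨k a, hkA a, rfl⟩, rfl⟩
  let F : I → ℝ := fun i => f i
  have hFmax : ∀ x ∈ ∑ a, simplex (A a), F ⬝ᵥ x ≤ F ⬝ᵥ ∑ a, stdVec (k a) := fun x hx =>
    dot_le_of_mem_sum_simplex (fun a i hi => Nat.cast_le.2 (hk a i hi)) hx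
  refine ⟨_, ⟨maxFace (∑ a, simplex (A a)) F, ⟨⟨_, hpQ, hFmax⟩, F, rfl⟩, rfl⟩, ?_⟩
  intro y hy x hx z hz
  have hyk : ∀ a, ∀ i ∈ A a, y i ≤ y (k a) := by
    intro a i hi
    rcases (hk a i hi).lt_or_eq with h | h
    · exact hf y hy _ _ h
    · rw [hfinj h]
  refine (dot_le_of_mem_sum_simplex hyk hz).trans ?_
  -- for large `M`, the functional `M F - y` is maximal at the same point as `F` and `y`
  obtain ⟨M, hM⟩ : ∃ M : ℝ, ∀ p : I × I, y p.1 - y p.2 ≤ M := by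
    obtain ⟨M, hM⟩ := (Set.finite_range fun p : I × I => y p.1 - y p.2).bddAbove
    exact ⟨M, fun p => hM ⟨p, rfl⟩⟩
  have hM0 : 0 ≤ max M 0 := le_max_right _ _
  have h1 : (max M 0 • F - y) ⬝ᵥ x ≤ (max M 0 • F - y) ⬝ᵥ ∑ a, stdVec (k a) := by
    refine dot_le_of_mem_sum_simplex (fun a i hi => ?_) hx.1
    simp only [Pi.sub_apply, Pi.smul_apply, smul_eq_mul, F]
    rcases (hk a i hi).lt_or_eq with h | h
    · have h2 : (f i : ℝ) + 1 ≤ f (k a) := by exact_mod_cast h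
      have h3 := hM (k a, i)
      have h4 : max M 0 * ((f i : ℝ) + 1) ≤ max M 0 * f (k a) :=
        mul_le_mul_of_nonneg_left h2 hM0
      have h5 := le_max_left M 0
      simp only at h3
      linarith
    · rw [hfinj h]
  have h2 := hx.2 _ hpQ
  rw [sub_dotProduct, sub_dotProduct, smul_dotProduct, smul_dotProduct, smul_eq_mul,
    smul_eq_mul] at h1
  have h3 := mul_le_mul_of_nonneg_left h2 hM0
  linarith

/-- The Loday associahedron as a generalized permutahedron. -/
noncomputable def assocGP (I : Type) [Fintype I] [LinearOrder I] : GenPerm I where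
  carrier := associahedron I
  isPolytope := isPolytope_sum_simplex _ fun p => ⟨p.1.1, le_rfl, p.2⟩
  coarsens := isCoarsening_sum_simplex _ fun p => ⟨p.1.1, le_rfl, p.2⟩

/-- `P` is a product of associahedra: there are linearly ordered sets `S_b` with
`I = ⊔ S_b` (through the bijection `e`) such that `P ⊆ ℝI` is the product of the associahedra of
the `S_b`. -/
def IsAssocProduct {I : Type} (P : Set (I → ℝ)) : Prop :=
  ∃ (k : ℕ) (S : Fin k → Type) (_ : ∀ b, Fintype (S b)) (_ : ∀ b, LinearOrder (S b))
    (e : (Σ b, S b) ≃ I), P = {x | ∀ b, (fun s => x (e ⟨b, s⟩)) ∈ associahedron (S b)}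

/-- The subspace of `GPBar[I]` spanned by (the classes of) the products of associahedra. -/
noncomputable def assocSpan (K : Type u) [Field K] (I : Type) [Fintype I] :
    Submodule K ((gpSpecies K).obj I) :=
  Submodule.span K {z | ∃ P : GenPerm I, IsAssocProduct P.carrier ∧
    z = (Finsupp.single (⟦P⟧ : GPBar I) 1 : GPBar I →₀ K)}

theorem assocSpan_map (K : Type u) [Field K] {I J : Type} [Fintype I] [Fintype J] (σ : I ≃ J) :
    ∀ z ∈ assocSpan K I, (gpSpecies K).map σ z ∈ assocSpan K J := by
  intro z hz
  have : assocSpan K I ≤ (assocSpan K J).comap ((gpSpecies K).map σ) := by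
    refine Submodule.span_le.2 ?_
    rintro _ ⟨P, ⟨k, S, iF, iL, e, hP⟩, rfl⟩
    refine Submodule.subset_span ⟨P.map σ, ⟨k, S, iF, iL, e.trans σ, ?_⟩, ?_⟩
    · change relabel σ P.carrier = _
      rw [hP]; rfl
    · exact Finsupp.mapDomain_single
  exact this hz

/-- The species of associahedra, a subspecies of `gpSpecies K`. -/
noncomputable def assocSpecies (K : Type u) [Field K] : VectorSpecies K where
  obj I _ := assocSpan K I
  map σ := ((gpSpecies K).map σ).restrict (assocSpan_map K σ)
  map_refl I _ := by
    ext z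
    exact congrArg (fun f => f z.1) (congrArg DFunLike.coe ((gpSpecies K).map_refl I))
  map_trans σ τ := by
    ext z
    exact congrArg (fun f => f z.1) (congrArg DFunLike.coe ((gpSpecies K).map_trans σ τ))

/-- The inclusion of the species of associahedra. -/
noncomputable def assocIncl (K : Type u) [Field K] : SpeciesHom (assocSpecies K) (gpSpecies K) where
  app I _ := (assocSpan K I).subtype
  naturality _ := rfl

theorem isAssocProduct_assoc (I : Type) [Fintype I] [LinearOrder I] :
    IsAssocProduct (associahedron I) := by
  refine ⟨1, fun _ => I, fun _ => inferInstance, fun _ => inferInstance,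
    { toFun := fun x => x.2
      invFun := fun i => ⟨0, i⟩
      left_inv := fun x => Sigma.ext (Subsingleton.elim _ _) HEq.rfl
      right_inv := fun _ => rfl }, ?_⟩
  ext x
  exact ⟨fun h _ => h, fun h => h 0⟩

/-- The element `a_ℓ` of the species of associahedra, for a linear order on `I`. -/
noncomputable def assocElt (K : Type u) [Field K] (I : Type) [Fintype I] [LinearOrder I] :
    (assocSpecies K).obj I :=
  ⟨(Finsupp.single (⟦assocGP I⟧ : GPBar I) 1 : GPBar I →₀ K),
    Submodule.subset_span ⟨assocGP I, isAssocProduct_assoc I, rfl⟩⟩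

/-- The element `a_n` of the Hopf algebra of associahedra. -/
noncomputable def assocClass (K : Type u) [Field K] (n : ℕ) : Fock (assocSpecies K) :=
  fockMk (assocSpecies K) n (assocElt K (Fin n))

/-- The Brion map on the Hopf algebra of associahedra, with values in the Hopf algebra of
posets. -/
noncomputable def brionAssoc (K : Type u) [Field K] :
    Fock (assocSpecies K) →ₗ[K] Fock (posetSpecies K) :=
  fockMap ((brion K).comp (assocIncl K))

/-! ### Unlabelled posets -/

/-- The number of maximal elements (elements not covered by any other element). -/
noncomputable def numMaximal (α : Type) [PartialOrder α] : ℕ :=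
  Nat.card {v : α // ∀ w, ¬ v ⋖ w}

/-- `v` is symmetric: it is covered by two elements above which the poset looks the same. -/
def IsSymmetricElt {α : Type} [PartialOrder α] (v : α) : Prop :=
  ∃ v₁ v₂ : α, v₁ ≠ v₂ ∧ v ⋖ v₁ ∧ v ⋖ v₂ ∧ Nonempty (Set.Ici v₁ ≃o Set.Ici v₂)

/-- The number of symmetric elements. -/
noncomputable def numSymmetric (α : Type) [PartialOrder α] : ℕ :=
  Nat.card {v : α // IsSymmetricElt v}

theorem numMaximal_congr {α β : Type} [PartialOrder α] [PartialOrder β] (e : α ≃o β) :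
    numMaximal α = numMaximal β := by
  refine Nat.card_congr (e.toEquiv.subtypeEquiv fun v => ?_)
  rw [← e.toEquiv.forall_congr_right]
  exact forall_congr' fun w => not_congr (apply_covBy_apply_iff e).symm

theorem IsSymmetricElt.map {α β : Type} [PartialOrder α] [PartialOrder β] (e : α ≃o β) {v : α}
    (h : IsSymmetricElt v) : IsSymmetricElt (e v) := by
  obtain ⟨v₁, v₂, hne, h1, h2, ⟨f⟩⟩ := h
  have g : ∀ v : α, Nonempty (Set.Ici v ≃o Set.Ici (e v)) := fun v =>
    ⟨{ toEquiv := e.toEquiv.subtypeEquiv fun w => (e.le_iff_le).symm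
       map_rel_iff' := e.le_iff_le }⟩
  obtain ⟨g1⟩ := g v₁
  obtain ⟨g2⟩ := g v₂
  exact ⟨e v₁, e v₂, e.injective.ne hne, (apply_covBy_apply_iff e).2 h1,
    (apply_covBy_apply_iff e).2 h2, ⟨(g1.symm.trans f).trans g2⟩⟩

theorem numSymmetric_congr {α β : Type} [PartialOrder α] [PartialOrder β] (e : α ≃o β) :
    numSymmetric α = numSymmetric β := by
  refine Nat.card_congr (e.toEquiv.subtypeEquiv fun v => ⟨IsSymmetricElt.map e, fun h => ?_⟩)
  have := IsSymmetricElt.map e.symm h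
  simpa using this

/-- Isomorphism of poset structures on `{1, …, n}`. -/
def posetIso (n : ℕ) : Setoid (PartialOrder (Fin n)) where
  r p q := Nonempty (@OrderIso (Fin n) (Fin n) p.toLE q.toLE)
  iseqv :=
    { refl := fun p => ⟨@OrderIso.refl (Fin n) p.toLE⟩
      symm := fun {p q} ⟨e⟩ => ⟨@OrderIso.symm _ _ p.toLE q.toLE e⟩
      trans := fun {p q r} ⟨e⟩ ⟨f⟩ => ⟨@OrderIso.trans _ _ _ p.toLE q.toLE r.toLE e f⟩ }

/-- Unlabelled posets on `n` elements: isomorphism classes of posets. -/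
def UnlabelledPoset (n : ℕ) : Type := Quotient (posetIso n)

/-- The number `m(p)` of maximal elements of an unlabelled poset. -/
noncomputable def UnlabelledPoset.m {n : ℕ} (c : UnlabelledPoset n) : ℕ :=
  Quotient.lift (fun p : PartialOrder (Fin n) => @numMaximal (Fin n) p)
    (fun p q h => Nonempty.elim h fun e => @numMaximal_congr _ _ p q e) c

/-- The number `s(p)` of symmetric elements of an unlabelled poset. -/
noncomputable def UnlabelledPoset.s {n : ℕ} (c : UnlabelledPoset n) : ℕ :=
  Quotient.lift (fun p : PartialOrder (Fin n) => @numSymmetric (Fin n) p)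
    (fun p q h => Nonempty.elim h fun e => @numSymmetric_congr _ _ p q e) c

/-- An unlabelled poset as an element of the Hopf algebra of posets: the class of any of its
labellings. -/
noncomputable def UnlabelledPoset.toFock (K : Type u) [Field K] {n : ℕ} (c : UnlabelledPoset n) :
    Fock (posetSpecies K) :=
  Quotient.lift (fun p : PartialOrder (Fin n) =>
      fockMk (posetSpecies K) n (Finsupp.single p 1 : PartialOrder (Fin n) →₀ K))
    (fun p q h => by
      obtain ⟨e⟩ := h
      let σ : Fin n ≃ Fin n := @RelIso.toEquiv _ _ p.le q.le e
      have h1 : posetRelabel σ p = q := by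
        refine PartialOrder.ext fun x y => ?_
        change p.le (σ.symm x) (σ.symm y) ↔ q.le x y
        have h2 := @RelIso.map_rel_iff _ _ p.le q.le e (σ.symm x) (σ.symm y)
        rw [← h2]
        change q.le (σ (σ.symm x)) (σ (σ.symm y)) ↔ _
        rw [Equiv.apply_symm_apply, Equiv.apply_symm_apply]
      have h3 : (posetSpecies K).map σ (Finsupp.single p 1 : PartialOrder (Fin n) →₀ K) =
          (Finsupp.single q 1 : PartialOrder (Fin n) →₀ K) := by
        rw [← h1]; exact Finsupp.mapDomain_single
      change fockMk (posetSpecies K) n _ = fockMk (posetSpecies K) n _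
      rw [← h3]
      exact (fockMk_map (posetSpecies K) n σ _).symm) c

instance finiteUnlabelledPoset (n : ℕ) : Finite (UnlabelledPoset n) := by
  have : Finite (PartialOrder (Fin n)) :=
    Finite.of_injective (fun p : PartialOrder (Fin n) => p.le) fun p q h =>
      PartialOrder.ext fun x y => by
        rw [show p.le = q.le from h]
  exact Quotient.finite _

/-! ### Rooted binary tree posets -/

/-- The poset of the pruned representation of a rooted binary tree: its elements are the internal
vertices, the root is the minimum, and the left and right sub-trees lie above it, without relations
between them. -/
def treePoset : BinaryTree Unit → PartOrd.{0}
  | .nil => PartOrd.of Empty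
  | .node _ l r => PartOrd.of (WithBot (treePoset l ⊕ treePoset r))

/-- `RBT_n`: the unlabelled rooted binary tree posets on `n` elements. -/
noncomputable def RBT (n : ℕ) : Finset (UnlabelledPoset n) :=
  (Set.toFinite {c : UnlabelledPoset n | ∃ T : BinaryTree Unit, T.numNodes = n ∧ ∃ p : PartialOrder (Fin n),
    Nonempty (@OrderIso (Fin n) (treePoset T) p.toLE _) ∧
      c = Quotient.mk (posetIso n) p}).toFinset

end BrionMap

/-!
Both sides are sums over binary trees.

*Geometry.* A functional `y` is maximal over the associahedron at `∑ e_{k(i, j)}`, where `k(i, j)`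
is a point of the interval `[i, j]` at which `y` is maximal. If `y` has no ties, the points `k(i, j)`
are the least elements of the intervals in the decreasing binary search tree of `y`. So the vertices
correspond to the partial orders of binary search trees, which are called search orders here and
are characterized without reference to trees (`IsSearchOrder`). The tangent cone at the vertex
`∑ e_{k(i, j)}` of a search order is the cone of this order (`IsSearchOrder.exists_vertex`). On the
one hand, every difference from this vertex to a point of the associahedron is a nonnegative
combination of vectors `e_b - e_k` with `k` below `b`. On the other hand, if `i` covers `j`, then a
functional that decreases along the order except for a tie between `i` and `j`
(`IsSearchOrder.exists_functional`) exposes an edge in direction `e_i - e_j`, because a face of a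
Minkowski sum is the sum of the faces (`maxFace_sum_simplex`); and the cover relations generate the
cone of the order. Hence the Brion map sends the associahedron to the sum of all search orders
(`brionSum_assocGP`).

*Trees.* In-order numbering identifies the search orders on `{1, …, n}` with the binary trees with
`n` internal vertices (`isSearchOrder_iff_exists_treeOrder`), and the search order of a tree is
isomorphic to the poset of the tree.

*Counting.* It remains to count the trees whose poset is isomorphic to that of a given tree. The
poset of a tree determines the sub-trees of the root up to isomorphism and up to a swap
(`nonempty_orderIso_node_iff`), so these trees arise by swapping sub-trees. A swap changes
the tree unless the vertex is maximal (both sub-trees are empty) or symmetric (they are nonempty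
with isomorphic posets, in which case the swap only permutes the choices for the two of them). By
induction there are `2 ^ (n - m - s)` of them (`card_treeVariants`).
-/

namespace BrionMap

/-! ### Faces of Minkowski sums of simplices -/

theorem stdVec_apply_self {I : Type} (k : I) : (stdVec k : I → ℝ) k = 1 := by
  simp [stdVec]

theorem stdVec_apply_of_ne {I : Type} {k i : I} (h : i ≠ k) : (stdVec k : I → ℝ) i = 0 := by
  simp [stdVec, h]

theorem simplex_coords {I : Type} [Fintype I] {A : Set I} {z : I → ℝ} (hz : z ∈ simplex A) :
    (∀ i, 0 ≤ z i) ∧ ∑ i, z i = 1 ∧ ∀ i, i ∉ A → z i = 0 := by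
  have h1 : simplex A ⊆ stdSimplex ℝ I := by
    refine convexHull_min ?_ (convex_stdSimplex ℝ I)
    rintro _ ⟨k, -, rfl⟩
    refine ⟨fun i => ?_, ?_⟩
    · by_cases h : i = k
      · rw [h, stdVec_apply_self]; exact zero_le_one
      · rw [stdVec_apply_of_ne h]
    · rw [Finset.sum_eq_single k (fun i _ h => stdVec_apply_of_ne h) (by simp),
        stdVec_apply_self]
  refine ⟨(h1 hz).1, (h1 hz).2, fun i hi => ?_⟩
  have hc : Convex ℝ {x : I → ℝ | x i = 0} := by
    intro x hx z hz a b _ _ _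
    simp only [Set.mem_ofPred_eq, Pi.add_apply, Pi.smul_apply, smul_eq_mul] at *
    rw [hx, hz]; ring
  refine (convexHull_min ?_ hc : simplex A ⊆ _) hz
  rintro _ ⟨k, hk, rfl⟩
  exact stdVec_apply_of_ne (k := k) fun h => hi (h ▸ hk)

/-- A point of a simplex on which `y` is maximal lies on the edge from `e_k` to `e_i`, if these
two are the only vertices on which `y` can be maximal. -/
theorem exists_eq_of_mem_simplex {I : Type} [Fintype I] {A : Set I} {y : I → ℝ} {k i : I}
    (hle : ∀ a ∈ A, y a ≤ y k) (heq : ∀ a ∈ A, y a = y k → a = k ∨ a = i)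
    {z : I → ℝ} (hz : z ∈ simplex A) (hmax : y ⬝ᵥ z = y k) :
    ∃ t : ℝ, 0 ≤ t ∧ t ≤ 1 ∧ (i ∉ A → t = 0) ∧ z = stdVec k + t • (stdVec i - stdVec k) := by
  classical
  obtain ⟨h0, h1, hA⟩ := simplex_coords hz
  have hsum : ∑ a, z a * (y k - y a) = 0 := by
    have : ∑ a, z a * (y k - y a) = (∑ a, z a) * y k - y ⬝ᵥ z := by
      rw [Finset.sum_mul, dotProduct, ← Finset.sum_sub_distrib]
      exact Finset.sum_congr rfl fun a _ => by ring
    rw [this, h1, hmax]; ring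
  have hterm : ∀ a ∈ Finset.univ, 0 ≤ z a * (y k - y a) := by
    intro a _
    by_cases ha : a ∈ A
    · exact mul_nonneg (h0 a) (sub_nonneg.2 (hle a ha))
    · rw [hA a ha, zero_mul]
  have hzero : ∀ a, a ≠ k → a ≠ i → z a = 0 := by
    intro a hk hi
    by_cases ha : a ∈ A
    · rcases mul_eq_zero.1 ((Finset.sum_eq_zero_iff_of_nonneg hterm).1 hsum a (Finset.mem_univ a))
        with h | h
      · exact h
      · rcases heq a ha (by linarith) with h' | h'
        · exact absurd h' hk
        · exact absurd h' hi
    · exact hA a ha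
  refine ⟨z i, h0 i, ?_, hA i, ?_⟩
  · rw [← h1]; exact Finset.single_le_sum (fun a _ => h0 a) (Finset.mem_univ i)
  · by_cases hik : i = k
    · subst hik
      have hi : z i = 1 := by
        rw [← h1, Finset.sum_eq_single i (fun a _ h => hzero a h h) (by simp)]
      ext a
      by_cases ha : a = i
      · subst ha; simp [hi, stdVec_apply_self]
      · simp [hzero a ha ha, stdVec_apply_of_ne ha]
    · have hk : z i + z k = 1 := by
        rw [← h1, ← Finset.sum_subset (Finset.subset_univ {i, k}), Finset.sum_pair hik]
        intro a _ ha
        simp only [Finset.mem_insert, Finset.mem_singleton, not_or] at ha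
        exact hzero a ha.2 ha.1
      ext a
      simp only [Pi.add_apply, Pi.smul_apply, Pi.sub_apply, smul_eq_mul]
      by_cases ha : a = i
      · subst ha; rw [stdVec_apply_of_ne hik, stdVec_apply_self]; ring
      · by_cases hak : a = k
        · subst hak; rw [stdVec_apply_of_ne ha, stdVec_apply_self]; linarith
        · rw [stdVec_apply_of_ne ha, stdVec_apply_of_ne hak, hzero a hak ha]; ring

theorem sum_stdVec_mem {I ι : Type} [Fintype I] [Fintype ι] {A : ι → Set I} {k : ι → I}
    (hk : ∀ a, k a ∈ A a) : ∑ a, stdVec (k a) ∈ ∑ a, simplex (A a) :=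
  (Set.mem_fintype_sum _ _).2 ⟨fun a => stdVec (k a),
    fun a => subset_convexHull ℝ _ ⟨k a, hk a, rfl⟩, rfl⟩

theorem sum_stdVec_mem_maxFace {I ι : Type} [Fintype I] [Fintype ι] {A : ι → Set I} {k : ι → I}
    (hk : ∀ a, k a ∈ A a) {y : I → ℝ} (hle : ∀ a, ∀ i ∈ A a, y i ≤ y (k a)) :
    ∑ a, stdVec (k a) ∈ maxFace (∑ a, simplex (A a)) y :=
  ⟨sum_stdVec_mem hk, fun _ hz => dot_le_of_mem_sum_simplex hle hz⟩

/-- If the only ties of `y` for the maximum over the sets `A a` are between `j` and `i`, with `j`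
the chosen maximum, then the `y`-maximal face of the Minkowski sum is a segment in direction
`e_i - e_j`, whose length counts the ties. -/
theorem maxFace_sum_simplex {I ι : Type} [Fintype I] [Fintype ι] {A : ι → Set I} {k : ι → I}
    (hk : ∀ a, k a ∈ A a) {y : I → ℝ} {i j : I}
    (hle : ∀ a, ∀ b ∈ A a, y b ≤ y (k a))
    (heq : ∀ a, ∀ b ∈ A a, y b = y (k a) → b = k a ∨ (k a = j ∧ b = i)) (hij : y i = y j) :
    maxFace (∑ a, simplex (A a)) y = segment ℝ (∑ a, stdVec (k a))
      (∑ a, stdVec (k a) + (Nat.card {a // k a = j ∧ i ∈ A a} : ℝ) • (stdVec i - stdVec j)) := by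
  classical
  have hnA : ∀ a, (A a).Nonempty := fun a => ⟨_, hk a⟩
  have hN : (Nat.card {a // k a = j ∧ i ∈ A a} : ℝ) =
      ∑ a, if k a = j ∧ i ∈ A a then (1 : ℝ) else 0 := by
    rw [Nat.card_eq_fintype_card, Fintype.card_subtype, Finset.sum_boole]
  set N : ℝ := (Nat.card {a // k a = j ∧ i ∈ A a} : ℝ) with hNdef
  have hv := sum_stdVec_mem_maxFace hk hle
  refine Set.Subset.antisymm ?_ ?_
  · intro x hx
    obtain ⟨g, hg, rfl⟩ := (Set.mem_fintype_sum _ _).1 hx.1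
    have hga : ∀ a ∈ Finset.univ, y ⬝ᵥ g a ≤ y (k a) := by
      intro a _
      have h := dot_le_of_mem_sum_simplex (ι := Unit) (A := fun _ => A a) (k := fun _ => k a)
        (fun _ => hle a) (x := g a) (by simpa using hg a)
      simpa [dot_stdVec] using h
    have hsum : ∑ a, y ⬝ᵥ g a = ∑ a, y (k a) := by
      refine le_antisymm (Finset.sum_le_sum hga) ?_
      have := hx.2 _ hv.1
      rwa [dotProduct_sum, dotProduct_sum, Finset.sum_congr rfl fun a _ => dot_stdVec y (k a)]
        at this
    have hmax := (Finset.sum_eq_sum_iff_of_le hga).1 hsum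
    have key : ∀ a, ∃ t : ℝ, 0 ≤ t ∧ (t ≤ if k a = j ∧ i ∈ A a then (1 : ℝ) else 0) ∧
        g a = stdVec (k a) + t • (stdVec i - stdVec j) := by
      intro a
      by_cases hc : k a = j
      · obtain ⟨t, h0, h1, hA, ht⟩ := exists_eq_of_mem_simplex (hle a) (i := i)
          (fun b hb h => (heq a b hb h).imp_right And.right) (hg a) (hmax a (Finset.mem_univ a))
        refine ⟨t, h0, ?_, by rw [ht, hc]⟩
        split_ifs with h
        · exact h1
        · exact (hA fun hi => h ⟨hc, hi⟩).le
      · obtain ⟨t, h0, h1, hA, ht⟩ := exists_eq_of_mem_simplex (hle a) (i := k a)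
          (fun b hb h => (heq a b hb h).imp_right fun h => absurd h.1 hc) (hg a)
          (hmax a (Finset.mem_univ a))
        refine ⟨0, le_rfl, by split_ifs <;> simp, by rw [ht]; simp⟩
    choose t h0 h1 ht using key
    have ht0 : 0 ≤ ∑ a, t a := Finset.sum_nonneg fun a _ => h0 a
    have htN : ∑ a, t a ≤ N := by rw [hN]; exact Finset.sum_le_sum fun a _ => h1 a
    rw [segment_eq_image']
    refine ⟨(∑ a, t a) / N, ⟨div_nonneg ht0 (ht0.trans htN), div_le_one_of_le₀ htN
      (ht0.trans htN)⟩, ?_⟩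
    have hdiv : (∑ a, t a) / N * N = ∑ a, t a := by
      by_cases hN0 : N = 0
      · rw [hN0, mul_zero]; linarith
      · exact div_mul_cancel₀ _ hN0
    simp only [ht, Finset.sum_add_distrib, ← Finset.sum_smul]
    rw [add_sub_cancel_left, smul_smul, hdiv]
  · refine (convex_maxFace (isPolytope_sum_simplex A hnA) y).segment_subset hv ?_
    have hw : ∑ a, stdVec (k a) + N • (stdVec i - stdVec j) =
        ∑ a, stdVec (if k a = j ∧ i ∈ A a then i else k a) := by
      rw [hN, Finset.sum_smul, ← Finset.sum_add_distrib]
      refine Finset.sum_congr rfl fun a _ => ?_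
      split_ifs with h
      · rw [h.1]; simp
      · simp
    have hyw : ∀ a, y (if k a = j ∧ i ∈ A a then i else k a) = y (k a) := by
      intro a
      split_ifs with h
      · rw [hij, h.1]
      · rfl
    rw [hw]
    refine sum_stdVec_mem_maxFace (fun a => ?_) fun a b hb => ?_
    · split_ifs with h
      · exact h.2
      · exact hk a
    · rw [hyw]; exact hle a b hb

theorem maxFace_sum_simplex_eq_singleton {I ι : Type} [Fintype I] [Fintype ι] {A : ι → Set I}
    {k : ι → I} (hk : ∀ a, k a ∈ A a) {y : I → ℝ}
    (hlt : ∀ a, ∀ b ∈ A a, b ≠ k a → y b < y (k a)) :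
    maxFace (∑ a, simplex (A a)) y = {∑ a, stdVec (k a)} := by
  refine Set.eq_singleton_iff_unique_mem.2 ⟨sum_stdVec_mem_maxFace hk fun a b hb => ?_, ?_⟩
  · by_cases h : b = k a
    · rw [h]
    · exact (hlt a b hb h).le
  · intro x hx
    obtain ⟨g, hg, rfl⟩ := (Set.mem_fintype_sum _ _).1 hx.1
    have hle : ∀ a, ∀ b ∈ A a, y b ≤ y (k a) := fun a b hb => by
      by_cases h : b = k a
      · rw [h]
      · exact (hlt a b hb h).le
    by_cases hι : Nonempty ι
    · obtain ⟨a⟩ := hι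
      have := maxFace_sum_simplex hk hle (i := k a) (j := k a)
        (fun a b hb h => Or.inl (by_contra fun hne => (hlt a b hb hne).ne h)) rfl
      rw [this] at hx
      simpa using hx
    · have := not_nonempty_iff.1 hι
      simp

/-- The directions from `∑ e_{k a}` into the Minkowski sum lie in the cone of `p`, if `k a` is the
`p`-least element of `A a` for all `a`. -/
theorem sub_mem_posetCone {I ι : Type} [Fintype I] [Fintype ι] {A : ι → Set I} {k : ι → I}
    {p : PartialOrder I} (hp : ∀ a, ∀ b ∈ A a, p.le (k a) b) {w : I → ℝ}
    (hw : w ∈ ∑ a, simplex (A a)) : w - ∑ a, stdVec (k a) ∈ posetCone p := by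
  obtain ⟨g, hg, rfl⟩ := (Set.mem_fintype_sum _ _).1 hw
  rw [← Finset.sum_sub_distrib]
  refine Submodule.sum_mem _ fun a _ => ?_
  have hc : Convex ℝ {x : I → ℝ | x - stdVec (k a) ∈ posetCone p} := by
    intro x hx z hz s t hs ht hst
    have e : s • x + t • z - stdVec (k a) =
        (⟨s, hs⟩ : {c : ℝ // 0 ≤ c}) • (x - stdVec (k a)) +
          (⟨t, ht⟩ : {c : ℝ // 0 ≤ c}) • (z - stdVec (k a)) := by
      change _ = s • (x - stdVec (k a)) + t • (z - stdVec (k a))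
      rw [smul_sub, smul_sub, sub_add_sub_comm, ← add_smul, hst, one_smul]
    change s • x + t • z - stdVec (k a) ∈ posetCone p
    rw [e]
    exact Submodule.add_mem _ (Submodule.smul_mem _ _ hx) (Submodule.smul_mem _ _ hz)
  refine (convexHull_min ?_ hc : simplex (A a) ⊆ _) (hg a)
  rintro _ ⟨b, hb, rfl⟩
  exact (mem_posetCone p b (k a)).2 (hp a b hb)

/-! ### Search orders and the vertices of the associahedron -/

/-- A partial order `r` on a linearly ordered set is a *search order* if every interval of the
linear order has an `r`-least element, and an element `r`-below `j` is also `r`-below everything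
that the linear order places between itself and `j`. These are the orders of binary search trees,
with the root as least element. The order is given as a bare relation, so that it does not compete
with the linear order for the notation `≤`. -/
structure IsSearchOrder {I : Type} [LinearOrder I] (r : I → I → Prop) : Prop where
  le_of_mem_uIcc : ∀ {i j k : I}, r i j → k ∈ Set.uIcc i j → r i k
  exists_least : ∀ a b : I, ∃ m ∈ Set.uIcc a b, ∀ k ∈ Set.uIcc a b, r m k

/-- The Hasse diagram of a search order is a forest: the elements below a given one form a
chain. -/
theorem IsSearchOrder.total_below {I : Type} [LinearOrder I] {r : I → I → Prop}
    (hr : IsSearchOrder r) (anti : ∀ a b, r a b → r b a → a = b) {a b c : I} (hac : r a c)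
    (hbc : r b c) : r a b ∨ r b a := by
  wlog hab : a ≤ b generalizing a b
  · exact (this hbc hac (le_of_not_ge hab)).symm
  rcases le_total b c with h | h
  · exact Or.inl (hr.le_of_mem_uIcc hac (Set.mem_uIcc_of_le hab h))
  rcases le_total c a with h' | h'
  · exact Or.inr (hr.le_of_mem_uIcc hbc (Set.mem_uIcc_of_ge h' hab))
  -- `c` lies between `a` and `b`, so the least element of `[a, b]` is `a` or `b`
  obtain ⟨m, hm, hml⟩ := hr.exists_least a b
  rw [Set.uIcc_of_le hab] at hm
  rcases le_total m c with h'' | h''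
  · have := anti _ _ (hml a Set.left_mem_uIcc)
      (hr.le_of_mem_uIcc hac (Set.mem_uIcc_of_le hm.1 h''))
    exact Or.inl (this ▸ hml b Set.right_mem_uIcc)
  · have := anti _ _ (hml b Set.right_mem_uIcc)
      (hr.le_of_mem_uIcc hbc (Set.mem_uIcc_of_ge h'' hm.2))
    exact Or.inr (this ▸ hml a Set.left_mem_uIcc)

/-- The number of elements strictly below `k`. -/
noncomputable def depth {I : Type} (p : PartialOrder I) (k : I) : ℕ :=
  Nat.card {l // p.lt l k}

theorem depth_lt {I : Type} [Finite I] (p : PartialOrder I) {a b : I} (h : p.lt a b) :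
    depth p a < depth p b := by
  refine Set.ncard_lt_ncard (s := {l | p.lt l a}) (t := {l | p.lt l b})
    ⟨fun l hl => @lt_trans I p.toPreorder _ _ _ hl h, fun hs => ?_⟩ (Set.toFinite _)
  exact @lt_irrefl I p.toPreorder a (hs h)

theorem IsSearchOrder.depth_covBy {I : Type} [Finite I] [LinearOrder I] {p : PartialOrder I}
    (hp : IsSearchOrder p.le) {j i : I} (h : @CovBy I p.toLT j i) :
    depth p i = depth p j + 1 := by
  have : {l | p.lt l i} = insert j {l | p.lt l j} := by
    ext l
    simp only [Set.mem_ofPred_eq, Set.mem_insert_iff]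
    constructor
    · intro hl
      rcases hp.total_below p.le_antisymm (le_of_lt hl) (le_of_lt h.1) with h1 | h1
      · exact @eq_or_lt_of_le I p _ _ h1
      · rcases @eq_or_lt_of_le I p _ _ h1 with h2 | h2
        · exact Or.inl h2.symm
        · exact absurd hl (h.2 h2)
    · rintro (rfl | hl)
      · exact h.1
      · exact @lt_trans I p.toPreorder _ _ _ hl h.1
  change Set.ncard {l | p.lt l i} = Set.ncard {l | p.lt l j} + 1
  rw [this]
  exact Set.ncard_insert_of_notMem (s := {l | p.lt l j}) (@lt_irrefl I p.toPreorder j)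
    (Set.toFinite _)

/-- Contracting one cover relation of a search order: there is a functional, decreasing along the
order, whose only tie along comparable elements is at the given cover. -/
theorem IsSearchOrder.exists_functional {I : Type} [Fintype I] [LinearOrder I]
    {p : PartialOrder I} (hp : IsSearchOrder p.le) {j i : I} (h : @CovBy I p.toLT j i) :
    ∃ y : I → ℝ, y i = y j ∧
      ∀ a b, p.le a b → y b ≤ y a ∧ (y b = y a → b = a ∨ (a = j ∧ b = i)) := by
  classical
  -- lift everything above `i` by one level
  refine ⟨fun k => (if p.le i k then 1 else 0) - (depth p k : ℝ), ?_, fun a b hab => ?_⟩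
  · have h1 : ¬ p.le i j := fun h' =>
      @lt_irrefl I p.toPreorder j (@lt_of_lt_of_le I p.toPreorder _ _ _ h.1 h')
    simp only [p.le_refl i, h1, if_true, if_false, hp.depth_covBy h]
    push_cast; ring
  · rcases @eq_or_lt_of_le I p _ _ hab with rfl | hlt
    · exact ⟨le_rfl, fun _ => Or.inl rfl⟩
    have hd := depth_lt p hlt
    have hd' : (depth p a : ℝ) + 1 ≤ depth p b := by exact_mod_cast hd
    by_cases hia : p.le i a
    · have hib := p.le_trans _ _ _ hia hab
      simp only [hia, hib, if_true]
      exact ⟨by linarith, fun he => by linarith⟩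
    by_cases hib : p.le i b
    · simp only [hia, hib, if_true, if_false]
      refine ⟨by linarith, fun he => Or.inr ?_⟩
      -- `a` and `i` lie below `b`, so `a < i ≤ b`, and the tie leaves no room between `a` and `b`
      have hai : p.lt a i := by
        rcases hp.total_below p.le_antisymm hab hib with h' | h'
        · exact @lt_of_le_of_ne I p _ _ h' fun e => hia (e ▸ p.le_refl _)
        · exact absurd h' hia
      have hbi : b = i := by
        by_contra hne
        have h1 := depth_lt p hai
        have h2 := depth_lt p (@lt_of_le_of_ne I p _ _ hib (Ne.symm hne))
        have h3 : (depth p a : ℝ) + 1 + 1 ≤ depth p b := by exact_mod_cast (by omega)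
        linarith
      subst hbi
      refine ⟨?_, rfl⟩
      rcases hp.total_below p.le_antisymm hab (le_of_lt h.1) with h' | h'
      · by_contra hne
        have h1 := depth_lt p (@lt_of_le_of_ne I p _ _ h' hne)
        have h2 := depth_lt p h.1
        have h3 : (depth p a : ℝ) + 1 + 1 ≤ depth p b := by exact_mod_cast (by omega)
        linarith
      · by_contra hne
        exact h.2 (@lt_of_le_of_ne I p _ _ h' (Ne.symm hne)) hlt
    · simp only [hia, hib, if_false]
      exact ⟨by linarith, fun he => by linarith⟩

/-- The cone of a finite poset is generated by its cover relations. -/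
theorem posetCone_le_of_covBy {I : Type} [Fintype I] {p : PartialOrder I}
    {C : PointedCone ℝ (I → ℝ)} (hC : ∀ j i, @CovBy I p.toLT j i → stdVec i - stdVec j ∈ C) :
    posetCone p ≤ C := by
  refine Submodule.span_le.2 ?_
  rintro _ ⟨i, j, hji, rfl⟩
  classical
  let _ := p
  let _ := Fintype.toLocallyFiniteOrder (α := I)
  have hsc : Relation.ReflTransGen (· ⋖ ·) j i := le_iff_reflTransGen_covBy.1 hji
  induction hsc with
  | refl => rw [sub_self]; exact C.zero_mem
  | tail h1 h2 ih =>
    have := C.add_mem (hC _ _ h2) (ih (le_iff_reflTransGen_covBy.2 h1))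
    rwa [sub_add_sub_cancel] at this

/-- The pairs of end points that index the summands of the associahedron. -/
abbrev IntervalPair (I : Type) [LinearOrder I] : Type := {q : I × I // q.1 ≤ q.2}

/-- The interval with given end points. -/
abbrev IntervalPair.toSet {I : Type} [LinearOrder I] (q : IntervalPair I) : Set I :=
  Set.Icc q.1.1 q.1.2

theorem IntervalPair.toSet_eq_uIcc {I : Type} [LinearOrder I] (q : IntervalPair I) :
    q.toSet = Set.uIcc q.1.1 q.1.2 :=
  (Set.uIcc_of_le q.2).symm

theorem IntervalPair.exists_toSet_eq {I : Type} [LinearOrder I] (i j : I) :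
    ∃ q : IntervalPair I, q.toSet = Set.uIcc i j :=
  ⟨⟨(min i j, max i j), min_le_max⟩, rfl⟩

/-- Every search order is the poset of a vertex of the associahedron, and this vertex is maximal
for all functionals that decrease along the order. -/
theorem IsSearchOrder.exists_vertex {I : Type} [Fintype I] [LinearOrder I] {p : PartialOrder I}
    (hp : IsSearchOrder p.le) : ∃ (v : I → ℝ) (hv : IsVertex (associahedron I) v),
      vertexPoset (associahedron I) v hv = p ∧
      ∀ y : I → ℝ, (∀ a b, p.le a b → y b ≤ y a) → v ∈ maxFace (associahedron I) y := by
  classical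
  let A : IntervalPair I → Set I := IntervalPair.toSet
  have hex : ∀ q, ∃ m ∈ A q, ∀ b ∈ A q, p.le m b := fun q => by
    simpa only [A, q.toSet_eq_uIcc] using hp.exists_least q.1.1 q.1.2
  choose k hkA hk using hex
  have hmax : ∀ y : I → ℝ, (∀ a b, p.le a b → y b ≤ y a) →
      ∑ a, stdVec (k a) ∈ maxFace (associahedron I) y := fun y hy =>
    sum_stdVec_mem_maxFace (A := A) hkA (y := y) fun a b hb => hy _ _ (hk a b hb)
  have hv : IsVertex (associahedron I) (∑ a, stdVec (k a)) := by
    refine ⟨Set.singleton_nonempty _, fun l => -(depth p l : ℝ), ?_⟩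
    refine (maxFace_sum_simplex_eq_singleton (A := A) hkA fun a b hb hne => ?_).symm
    have := depth_lt p (@lt_of_le_of_ne I p _ _ (hk a b hb) (Ne.symm hne))
    exact neg_lt_neg (by exact_mod_cast this)
  refine ⟨_, hv, vertexPoset_eq _ _ hv p (le_antisymm ?_ ?_), hmax⟩
  · -- each cover relation is the direction of an edge
    refine posetCone_le_of_covBy fun j i hji => ?_
    obtain ⟨y, hyij, hy⟩ := hp.exists_functional hji
    have hface := maxFace_sum_simplex (A := A) hkA (y := y) (i := i) (j := j)
      (fun a b hb => (hy _ _ (hk a b hb)).1) (fun a b hb => (hy _ _ (hk a b hb)).2) hyij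
    set N : ℝ := (Nat.card {a // k a = j ∧ i ∈ A a} : ℝ) with hN
    -- the tie at `j` and `i` occurs on the interval with these end points
    have hNpos : 0 < N := by
      have : Nonempty {a // k a = j ∧ i ∈ A a} := by
        obtain ⟨q, hq⟩ : ∃ q, A q = Set.uIcc j i := IntervalPair.exists_toSet_eq j i
        have hj : j ∈ A q := by rw [hq]; exact Set.left_mem_uIcc
        have hi : i ∈ A q := by rw [hq]; exact Set.right_mem_uIcc
        refine ⟨⟨q, p.le_antisymm _ _ (hk q j hj) ?_, hi⟩⟩
        exact hp.le_of_mem_uIcc (le_of_lt hji.1) (hq ▸ hkA q)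
      exact Nat.cast_pos.2 Nat.card_pos
    have hne : i ≠ j := fun e => @lt_irrefl I p.toPreorder j (e ▸ hji.1)
    have hd : (stdVec i - stdVec j : I → ℝ) ≠ 0 := fun e => by
      have := congrFun e i
      rw [Pi.sub_apply, stdVec_apply_self, stdVec_apply_of_ne hne] at this
      norm_num at this
    have hmem : N • (stdVec i - stdVec j : I → ℝ) ∈
        tangentCone (associahedron I) (∑ a, stdVec (k a)) := by
      refine Submodule.subset_span ⟨_, ⟨fun e => ?_, ⟨_, left_mem_segment ℝ _ _⟩, y, hface.symm⟩,
        (add_sub_cancel_left _ _).symm⟩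
      rw [left_eq_add] at e
      exact (smul_ne_zero hNpos.ne' hd) e
    have := Submodule.smul_mem _ (⟨N⁻¹, inv_nonneg.2 hNpos.le⟩ : {c : ℝ // 0 ≤ c}) hmem
    change N⁻¹ • N • (stdVec i - stdVec j : I → ℝ) ∈ _ at this
    rwa [smul_smul, inv_mul_cancel₀ hNpos.ne', one_smul] at this
  · refine Submodule.span_le.2 ?_
    rintro _ ⟨w, ⟨-, -, y, hy⟩, rfl⟩
    have hw : w ∈ maxFace (associahedron I) y := hy ▸ right_mem_segment ℝ _ _
    exact sub_mem_posetCone (A := A) hk hw.1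

/-- The search order of an injective function `f` to a linear order: `i` lies below `j` if `f` is
maximal at `i` over the interval between `i` and `j`. -/
@[reducible] def searchOrderOf {I L : Type} [LinearOrder I] [LinearOrder L] (f : I → L)
    (hf : Function.Injective f) : PartialOrder I where
  le i j := ∀ k ∈ Set.uIcc i j, f k ≤ f i
  lt i j := (∀ k ∈ Set.uIcc i j, f k ≤ f i) ∧ ¬ ∀ k ∈ Set.uIcc j i, f k ≤ f j
  lt_iff_le_not_ge _ _ := Iff.rfl
  le_refl i k hk := by rw [Set.uIcc_self] at hk; rw [show k = i from hk]
  le_trans i j k hij hjk l hl := by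
    rcases Set.uIcc_subset_uIcc_union_uIcc (b := j) hl with h | h
    · exact hij l h
    · exact (hjk l h).trans (hij j Set.right_mem_uIcc)
  le_antisymm i j hij hji :=
    hf (le_antisymm (hji i Set.right_mem_uIcc) (hij j Set.right_mem_uIcc))

theorem isSearchOrder_searchOrderOf {I L : Type} [Finite I] [LinearOrder I] [LinearOrder L]
    (f : I → L) (hf : Function.Injective f) : IsSearchOrder (searchOrderOf f hf).le where
  le_of_mem_uIcc hij hk l hl := hij l (Set.uIcc_subset_uIcc Set.left_mem_uIcc hk hl)
  exists_least a b := by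
    obtain ⟨m, hm, hmax⟩ := Set.exists_max_image (Set.uIcc a b) f (Set.toFinite _)
      ⟨a, Set.left_mem_uIcc⟩
    exact ⟨m, hm, fun k hk l hl => hmax l (Set.uIcc_subset_uIcc hm hk hl)⟩

/-- Every functional decreases along some search order: break its ties with the linear order. -/
theorem exists_isSearchOrder_antitone {I : Type} [Finite I] [LinearOrder I] (y : I → ℝ) :
    ∃ p : PartialOrder I, IsSearchOrder p.le ∧ ∀ a b, p.le a b → y b ≤ y a := by
  let f : I → ℝ ×ₗ I := fun k => toLex (y k, k)
  have hf : Function.Injective f := fun a b h => congrArg (fun z => (ofLex z).2) h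
  refine ⟨searchOrderOf f hf, isSearchOrder_searchOrderOf f hf, fun a b hab => ?_⟩
  have h : f b ≤ f a := hab b Set.right_mem_uIcc
  rcases Prod.Lex.le_iff.1 h with h | h
  · exact h.le
  · exact h.1.le

/-- The Brion sum of the associahedron is the sum of the search orders. -/
theorem brionSum_assocGP (K : Type u) [Field K] {I : Type} [Fintype I] [LinearOrder I]
    {ι : Type} [Fintype ι] (f : ι → PartialOrder I) (hf : Function.Injective f)
    (hs : ∀ p, IsSearchOrder p.le ↔ ∃ i, f i = p) :
    brionSum K (assocGP I) = ∑ i, Finsupp.single (f i) 1 := by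
  choose v hv hvp hvmax using fun i => ((hs (f i)).2 ⟨i, rfl⟩).exists_vertex
  refine (Fintype.sum_bijective (fun i => (⟨v i, hv i⟩ : (assocGP I).vertices))
    ⟨fun i j hij => hf ?_, fun w => ?_⟩ _ _ fun i => ?_).symm
  · rw [← hvp i, ← hvp j]
    have : v i = v j := congrArg Subtype.val hij
    congr!
  · obtain ⟨w, hw⟩ := w
    obtain ⟨-, y, hy⟩ := id hw
    obtain ⟨p, hp, hpy⟩ := exists_isSearchOrder_antitone y
    obtain ⟨i, rfl⟩ := (hs p).1 hp
    have h : v i ∈ ({w} : Set (I → ℝ)) := by rw [hy]; exact hvmax i y hpy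
    exact ⟨i, Subtype.ext h⟩
  · exact congrArg (fun p => Finsupp.single p 1) (hvp i).symm

/-! ### Search orders and binary trees -/

/-- The order relation of a binary tree whose internal vertices are numbered in-order, starting
with `a`: the root `a + |l|` lies below everything, and the vertices of the two sub-trees are
related within these sub-trees. -/
def treeRel : BinaryTree Unit → ℕ → ℕ → ℕ → Prop
  | .nil, _, _, _ => False
  | .node _ l r, a, i, j =>
    (i = a + l.numNodes ∧ a ≤ j ∧ j < a + (l.numNodes + r.numNodes + 1)) ∨
      treeRel l a i j ∨ treeRel r (a + l.numNodes + 1) i j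

/-- The in-order number, starting with `a`, of an internal vertex of a binary tree. -/
def treePos : (T : BinaryTree Unit) → ℕ → treePoset T → ℕ
  | .nil, _ => Empty.elim
  | .node _ l r, a => WithBot.recBotCoe (a + l.numNodes)
      (Sum.elim (treePos l a) (treePos r (a + l.numNodes + 1)))

/-- Case distinction for the elements of the poset of a tree: the root, the vertices of the left
sub-tree, and those of the right sub-tree. -/
theorem treePoset_node_cases {l r : BinaryTree Unit} {u : Unit} {C : treePoset (.node u l r) → Prop}
    (bot : C (⊥ : WithBot (treePoset l ⊕ treePoset r)))
    (inl : ∀ x : treePoset l, C ((Sum.inl x : treePoset l ⊕ treePoset r) : WithBot _))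
    (inr : ∀ x : treePoset r, C ((Sum.inr x : treePoset l ⊕ treePoset r) : WithBot _))
    (x : treePoset (.node u l r)) : C x := by
  induction x using WithBot.recBotCoe with
  | bot => exact bot
  | coe x =>
    cases x with
    | inl x => exact inl x
    | inr x => exact inr x

theorem treeRel_bounds {T : BinaryTree Unit} {a i j : ℕ} (h : treeRel T a i j) :
    (a ≤ i ∧ i < a + T.numNodes) ∧ a ≤ j ∧ j < a + T.numNodes := by
  induction T generalizing a with
  | nil => exact h.elim
  | node u l r hl hr =>
    simp only [BinaryTree.numNodes]
    rcases h with h | h | h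
    · omega
    · have := hl h; omega
    · have := hr h; omega

theorem treePos_bounds (T : BinaryTree Unit) (a : ℕ) (x : treePoset T) :
    a ≤ treePos T a x ∧ treePos T a x < a + T.numNodes := by
  induction T generalizing a with
  | nil => exact x.elim
  | node u l r hl hr =>
    simp only [BinaryTree.numNodes]
    induction x using treePoset_node_cases with
    | bot => change a ≤ a + l.numNodes ∧ a + l.numNodes < _; omega
    | inl x => have := hl a x; change a ≤ treePos l a x ∧ treePos l a x < _; omega
    | inr x =>
      have := hr (a + l.numNodes + 1) x
      change a ≤ treePos r (a + l.numNodes + 1) x ∧ treePos r (a + l.numNodes + 1) x < _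
      omega

theorem exists_treePos_eq (T : BinaryTree Unit) {a i : ℕ} (h1 : a ≤ i) (h2 : i < a + T.numNodes) :
    ∃ x, treePos T a x = i := by
  induction T generalizing a with
  | nil => simp only [BinaryTree.numNodes] at h2; omega
  | node u l r hl hr =>
    simp only [BinaryTree.numNodes] at h2
    rcases lt_trichotomy i (a + l.numNodes) with h | h | h
    · obtain ⟨x, hx⟩ := hl h1 h
      exact ⟨((Sum.inl x : treePoset l ⊕ treePoset r) : WithBot (treePoset l ⊕ treePoset r)), hx⟩
    · exact ⟨(⊥ : WithBot (treePoset l ⊕ treePoset r)), h.symm⟩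
    · obtain ⟨x, hx⟩ := hr (a := a + l.numNodes + 1) h (by omega)
      exact ⟨((Sum.inr x : treePoset l ⊕ treePoset r) : WithBot (treePoset l ⊕ treePoset r)), hx⟩

theorem treeRel_node_left {u : Unit} {l r : BinaryTree Unit} {a i j : ℕ}
    (hi : i < a + l.numNodes) : treeRel (.node u l r) a i j ↔ treeRel l a i j := by
  refine ⟨fun h => ?_, fun h => Or.inr (Or.inl h)⟩
  rcases h with h | h | h
  · omega
  · exact h
  · have := treeRel_bounds h; omega

theorem treeRel_node_right {u : Unit} {l r : BinaryTree Unit} {a i j : ℕ}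
    (hi : a + l.numNodes < i) :
    treeRel (.node u l r) a i j ↔ treeRel r (a + l.numNodes + 1) i j := by
  refine ⟨fun h => ?_, fun h => Or.inr (Or.inr h)⟩
  rcases h with h | h | h
  · omega
  · have := treeRel_bounds h; omega
  · exact h

theorem treeRel_node_root {u : Unit} {l r : BinaryTree Unit} {a j : ℕ} :
    treeRel (.node u l r) a (a + l.numNodes) j ↔
      a ≤ j ∧ j < a + (l.numNodes + r.numNodes + 1) := by
  refine ⟨fun h => ?_, fun h => Or.inl ⟨rfl, h⟩⟩
  have := treeRel_bounds h
  simp only [BinaryTree.numNodes] at this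
  omega

theorem treeRel_treePos (T : BinaryTree Unit) (a : ℕ) (x y : treePoset T) :
    treeRel T a (treePos T a x) (treePos T a y) ↔ x ≤ y := by
  induction T generalizing a with
  | nil => exact x.elim
  | node u l r hl hr =>
    have hy := treePos_bounds (.node u l r) a y
    simp only [BinaryTree.numNodes] at hy
    induction x using treePoset_node_cases with
    | bot =>
      refine iff_of_true (treeRel_node_root.2 hy) ?_
      exact bot_le (α := WithBot (treePoset l ⊕ treePoset r))
    | inl x =>
      have hx := treePos_bounds l a x
      refine (treeRel_node_left hx.2).trans ?_
      induction y using treePoset_node_cases with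
      | bot =>
        refine iff_of_false (fun h => ?_) (WithBot.not_coe_le_bot _)
        have h1 := (treeRel_bounds h).2.2
        change a + l.numNodes < _ at h1
        omega
      | inl y =>
        refine (hl a x y).trans ?_
        exact (WithBot.coe_le_coe.trans Sum.inl_le_inl_iff).symm
      | inr y =>
        refine iff_of_false (fun h => ?_) fun h => Sum.not_inl_le_inr (WithBot.coe_le_coe.1 h)
        have h1 := (treeRel_bounds h).2.2
        have h2 := treePos_bounds r (a + l.numNodes + 1) y
        change treePos r (a + l.numNodes + 1) y < _ at h1
        omega
    | inr x =>
      have hx := treePos_bounds r (a + l.numNodes + 1) x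
      refine (treeRel_node_right hx.1).trans ?_
      induction y using treePoset_node_cases with
      | bot =>
        refine iff_of_false (fun h => ?_) (WithBot.not_coe_le_bot _)
        have h1 := (treeRel_bounds h).2.1
        change _ ≤ a + l.numNodes at h1
        omega
      | inl y =>
        refine iff_of_false (fun h => ?_) fun h => Sum.not_inr_le_inl (WithBot.coe_le_coe.1 h)
        have h1 := (treeRel_bounds h).2.1
        have h2 := treePos_bounds l a y
        change _ ≤ treePos l a y at h1
        omega
      | inr y =>
        refine (hr _ x y).trans ?_
        exact (WithBot.coe_le_coe.trans Sum.inr_le_inr_iff).symm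

theorem treePos_injective (T : BinaryTree Unit) (a : ℕ) : Function.Injective (treePos T a) := by
  intro x y h
  have h1 : x ≤ y := (treeRel_treePos T a x y).1 (h ▸ (treeRel_treePos T a x x).2 le_rfl)
  have h2 : y ≤ x := (treeRel_treePos T a y x).1 (h ▸ (treeRel_treePos T a y y).2 le_rfl)
  exact le_antisymm h1 h2

theorem treeRel_of_mem_uIcc {T : BinaryTree Unit} {a i j k : ℕ} (h : treeRel T a i j)
    (hk : k ∈ Set.uIcc i j) : treeRel T a i k := by
  induction T generalizing a with
  | nil => exact h.elim
  | node u l r hl hr =>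
    rw [Set.mem_uIcc] at hk
    rcases h with h | h | h
    · exact Or.inl (by omega)
    · exact Or.inr (Or.inl (hl h))
    · exact Or.inr (Or.inr (hr h))

theorem exists_treeRel_least {T : BinaryTree Unit} {a i j : ℕ} (hi : a ≤ i) (hj : j < a + T.numNodes)
    (hij : i ≤ j) : ∃ m, (i ≤ m ∧ m ≤ j) ∧ ∀ k, i ≤ k → k ≤ j → treeRel T a m k := by
  induction T generalizing a with
  | nil => simp only [BinaryTree.numNodes] at hj; omega
  | node u l r hl hr =>
    simp only [BinaryTree.numNodes] at hj
    by_cases h1 : j < a + l.numNodes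
    · obtain ⟨m, hm, hmk⟩ := hl hi h1
      exact ⟨m, hm, fun k h h' => Or.inr (Or.inl (hmk k h h'))⟩
    by_cases h2 : a + l.numNodes < i
    · obtain ⟨m, hm, hmk⟩ := hr (a := a + l.numNodes + 1) h2 (by omega)
      exact ⟨m, hm, fun k h h' => Or.inr (Or.inr (hmk k h h'))⟩
    exact ⟨a + l.numNodes, by omega, fun k h h' => Or.inl (by omega)⟩

theorem treeRel_self {T : BinaryTree Unit} {a i : ℕ} (hi : a ≤ i) (hi' : i < a + T.numNodes) :
    treeRel T a i i := by
  obtain ⟨x, rfl⟩ := exists_treePos_eq T hi hi'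
  exact (treeRel_treePos T a x x).2 le_rfl

theorem treeRel_antisymm {T : BinaryTree Unit} {a i j : ℕ} (h : treeRel T a i j)
    (h' : treeRel T a j i) : i = j := by
  obtain ⟨x, rfl⟩ := exists_treePos_eq T (treeRel_bounds h).1.1 (treeRel_bounds h).1.2
  obtain ⟨y, rfl⟩ := exists_treePos_eq T (treeRel_bounds h').1.1 (treeRel_bounds h').1.2
  rw [le_antisymm ((treeRel_treePos T a x y).1 h) ((treeRel_treePos T a y x).1 h')]

theorem treeRel_trans {T : BinaryTree Unit} {a i j k : ℕ} (h : treeRel T a i j)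
    (h' : treeRel T a j k) : treeRel T a i k := by
  obtain ⟨x, rfl⟩ := exists_treePos_eq T (treeRel_bounds h).1.1 (treeRel_bounds h).1.2
  obtain ⟨y, rfl⟩ := exists_treePos_eq T (treeRel_bounds h').1.1 (treeRel_bounds h').1.2
  obtain ⟨z, rfl⟩ := exists_treePos_eq T (treeRel_bounds h').2.1 (treeRel_bounds h').2.2
  exact (treeRel_treePos T a x z).2
    (((treeRel_treePos T a x y).1 h).trans ((treeRel_treePos T a y z).1 h'))

/-- A binary tree is determined by its in-order numbered order relation. -/
theorem eq_of_treeRel_iff {T T' : BinaryTree Unit} {a : ℕ} (hn : T.numNodes = T'.numNodes)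
    (h : ∀ i j, treeRel T a i j ↔ treeRel T' a i j) : T = T' := by
  induction T generalizing T' a with
  | nil =>
    cases T' with
    | nil => rfl
    | node => simp [BinaryTree.numNodes] at hn
  | node u l r hl hr =>
    cases T' with
    | nil => simp [BinaryTree.numNodes] at hn
    | node u' l' r' =>
      simp only [BinaryTree.numNodes] at hn
      -- both roots are the least element
      have hroot : l.numNodes = l'.numNodes := by
        have h1 : treeRel (.node u' l' r') a (a + l.numNodes) (a + l'.numNodes) :=
          (h _ _).1 (treeRel_node_root.2 (by omega))
        have h2 : treeRel (.node u' l' r') a (a + l'.numNodes) (a + l.numNodes) :=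
          treeRel_node_root.2 (by omega)
        have := treeRel_antisymm h1 h2
        omega
      have hleft : l = l' := hl hroot fun i j => by
        by_cases hi : i < a + l.numNodes
        · rw [← treeRel_node_left (u := u) (r := r) hi, h, treeRel_node_left (hroot ▸ hi)]
        · exact iff_of_false (fun h' => hi (treeRel_bounds h').1.2)
            fun h' => hi (hroot ▸ (treeRel_bounds h').1.2)
      have hright : r = r' := hr (a := a + l.numNodes + 1) (by omega) fun i j => by
        by_cases hi : a + l.numNodes < i
        · rw [← treeRel_node_right (u := u) hi, h, treeRel_node_right (hroot ▸ hi), hroot]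
        · exact iff_of_false (fun h' => hi (treeRel_bounds h').1.1)
            fun h' => hi (treeRel_bounds h').1.1
      rw [hleft, hright]

/-- Every search order on an interval of the natural numbers comes from a binary tree: the root is
the least element, and the two sub-trees come from the elements to its left and to its right. -/
theorem exists_treeRel_iff {R : ℕ → ℕ → Prop} (anti : ∀ i j, R i j → R j i → i = j)
    (hmem : ∀ i j k, R i j → k ∈ Set.uIcc i j → R i k) (a n : ℕ)
    (hex : ∀ i j, a ≤ i → i ≤ j → j < a + n → ∃ m, (i ≤ m ∧ m ≤ j) ∧ ∀ k, i ≤ k → k ≤ j → R m k) :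
    ∃ T : BinaryTree Unit, T.numNodes = n ∧
      ∀ i j, a ≤ i → i < a + n → a ≤ j → j < a + n → (R i j ↔ treeRel T a i j) := by
  induction n using Nat.strong_induction_on generalizing a with
  | _ n ih =>
    obtain _ | n := n
    · exact ⟨.nil, rfl, fun i j _ _ _ _ => by omega⟩
    obtain ⟨m, hm, hmk⟩ := hex a (a + n) le_rfl (by omega) (by omega)
    obtain ⟨l, hl, hlR⟩ := ih (m - a) (by omega) a fun i j h1 h2 h3 => hex i j h1 h2 (by omega)
    obtain ⟨r, hr, hrR⟩ := ih (a + n - m) (by omega) (m + 1) fun i j h1 h2 h3 =>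
      hex i j (by omega) h2 (by omega)
    have hml : a + l.numNodes = m := by omega
    refine ⟨.node () l r, by simp only [BinaryTree.numNodes]; omega, fun i j h1 h2 h3 h4 => ?_⟩
    -- no other element is below something on the other side of the root
    have hcross : R i j → m ∈ Set.uIcc i j → i = m := fun h h' =>
      anti _ _ (hmem i j m h h') (hmk i h1 (by omega))
    simp only [Set.mem_uIcc] at hcross
    rcases lt_trichotomy i m with h | h | h
    · rw [treeRel_node_left (hml.symm ▸ h)]
      by_cases hj : j < m
      · exact hlR i j h1 (by omega) h3 (by omega)
      · refine iff_of_false (fun h' => ?_) fun h' => ?_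
        · have := hcross h'; omega
        · have := treeRel_bounds h'; omega
    · subst h
      refine iff_of_true (hmk j h3 (by omega)) ?_
      exact Or.inl (by omega)
    · rw [treeRel_node_right (hml.symm ▸ h), hml]
      by_cases hj : m < j
      · exact hrR i j (by omega) (by omega) (by omega) (by omega)
      · refine iff_of_false (fun h' => ?_) fun h' => ?_
        · have := hcross h'; omega
        · have := treeRel_bounds h'; omega

/-- The binary trees with `n` internal vertices. -/
abbrev TreesWithNodes (n : ℕ) : Type := {T : BinaryTree Unit // T.numNodes = n}

instance fintypeTreesWithNodes (n : ℕ) : Fintype (TreesWithNodes n) :=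
  Fintype.subtype (BinaryTree.treesOfNumNodesEq n) fun _ => BinaryTree.mem_treesOfNumNodesEq

/-- The poset of a binary tree with `n` internal vertices, labelled in-order by `{1, …, n}`. -/
@[reducible] def treeOrder {n : ℕ} (T : TreesWithNodes n) : PartialOrder (Fin n) where
  le i j := treeRel T.1 0 i j
  lt i j := treeRel T.1 0 i j ∧ ¬ treeRel T.1 0 j i
  lt_iff_le_not_ge _ _ := Iff.rfl
  le_refl i := treeRel_self (Nat.zero_le _) (by rw [T.2, zero_add]; exact i.2)
  le_trans _ _ _ h h' := treeRel_trans h h'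
  le_antisymm _ _ h h' := Fin.ext (treeRel_antisymm h h')

theorem nonempty_orderIso_treeOrder {n : ℕ} (T : TreesWithNodes n) :
    Nonempty (@OrderIso (Fin n) (treePoset T.1) (treeOrder T).toLE _) := by
  have hb := fun x => treePos_bounds T.1 0 x
  simp only [T.2, zero_add] at hb
  let f : treePoset T.1 → Fin n := fun x => ⟨treePos T.1 0 x, (hb x).2⟩
  have hf : Function.Bijective f := by
    refine ⟨fun x y h => treePos_injective T.1 0 (congrArg Fin.val h), fun i => ?_⟩
    obtain ⟨x, hx⟩ := exists_treePos_eq T.1 (Nat.zero_le i.1) (by rw [T.2, zero_add]; exact i.2)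
    exact ⟨x, Fin.ext hx⟩
  let e : @OrderIso (treePoset T.1) (Fin n) _ (treeOrder T).toLE :=
    @RelIso.mk _ _ _ (treeOrder T).le (Equiv.ofBijective f hf)
      fun {x y} => treeRel_treePos T.1 0 x y
  exact ⟨@OrderIso.symm _ _ _ (treeOrder T).toLE e⟩

theorem treeOrder_injective (n : ℕ) : Function.Injective (treeOrder (n := n)) := by
  intro T T' h
  refine Subtype.ext (eq_of_treeRel_iff (a := 0) (T.2.trans T'.2.symm) fun i j => ?_)
  have key : ∀ i j : Fin n, treeRel T.1 0 i j ↔ treeRel T'.1 0 i j := fun i j => by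
    change (treeOrder T).le i j ↔ (treeOrder T').le i j
    rw [h]
  have hb : ∀ S : TreesWithNodes n, treeRel S.1 0 i j → i < n ∧ j < n := fun S hS => by
    have := treeRel_bounds hS
    rw [S.2] at this
    omega
  exact ⟨fun h' => (key ⟨i, (hb T h').1⟩ ⟨j, (hb T h').2⟩).1 h',
    fun h' => (key ⟨i, (hb T' h').1⟩ ⟨j, (hb T' h').2⟩).2 h'⟩

theorem isSearchOrder_treeOrder {n : ℕ} (T : TreesWithNodes n) :
    IsSearchOrder (treeOrder T).le where
  le_of_mem_uIcc {i j k} hij hk := by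
    refine treeRel_of_mem_uIcc (T := T.1) (j := j) hij ?_
    rw [Set.mem_uIcc] at hk ⊢
    exact hk
  exists_least i j := by
    obtain ⟨m, hm, hmk⟩ := exists_treeRel_least (T := T.1) (a := 0) (i := min i.1 j.1)
      (j := max i.1 j.1) (Nat.zero_le _) (by rw [T.2]; omega) min_le_max
    refine ⟨⟨m, by omega⟩, ?_, fun k hk => hmk k ?_ ?_⟩
    · rw [Set.mem_uIcc, Fin.le_def, Fin.le_def, Fin.le_def, Fin.le_def]
      simp only
      omega
    all_goals
      rw [Set.mem_uIcc, Fin.le_def, Fin.le_def, Fin.le_def, Fin.le_def] at hk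
      omega

/-- The search orders on `{1, …, n}` are the posets of the binary trees with `n` internal
vertices, labelled in-order. -/
theorem isSearchOrder_iff_exists_treeOrder {n : ℕ} (p : PartialOrder (Fin n)) :
    IsSearchOrder p.le ↔ ∃ T, treeOrder T = p := by
  refine ⟨fun hp => ?_, fun ⟨T, hT⟩ => hT ▸ isSearchOrder_treeOrder T⟩
  obtain ⟨T, hn, hT⟩ := exists_treeRel_iff
    (R := fun i j => ∃ (hi : i < n) (hj : j < n), p.le ⟨i, hi⟩ ⟨j, hj⟩)
    (fun i j ⟨hi, hj, h⟩ ⟨_, _, h'⟩ => congrArg Fin.val (p.le_antisymm _ _ h h'))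
    (fun i j k ⟨hi, hj, h⟩ hk => by
      have hkn : k < n := by rw [Set.mem_uIcc] at hk; omega
      refine ⟨hi, hkn, hp.le_of_mem_uIcc h ?_⟩
      rw [Set.mem_uIcc] at hk ⊢
      exact hk) 0 n
    (fun i j _ hij hj => by
      rw [zero_add] at hj
      obtain ⟨m, hm, hmk⟩ := hp.exists_least ⟨i, by omega⟩ ⟨j, hj⟩
      have e : ∀ k : Fin n, k ∈ Set.uIcc (⟨i, by omega⟩ : Fin n) ⟨j, hj⟩ ↔ i ≤ k.1 ∧ k.1 ≤ j := by
        intro k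
        rw [Set.mem_uIcc, Fin.le_def, Fin.le_def, Fin.le_def, Fin.le_def]
        simp only
        omega
      exact ⟨m, (e m).1 hm, fun k h1 h2 =>
        ⟨m.2, by omega, hmk ⟨k, by omega⟩ ((e _).2 ⟨h1, h2⟩)⟩⟩)
  refine ⟨⟨T, hn⟩, PartialOrder.ext fun i j => ?_⟩
  refine (hT i j (Nat.zero_le _) (by omega) (Nat.zero_le _) (by omega)).symm.trans ?_
  exact ⟨fun ⟨_, _, h⟩ => h, fun h => ⟨i.2, j.2, h⟩⟩

/-! ### Isomorphisms between posets of trees -/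

theorem nonempty_orderIso_of_withBot {X Y : Type} [PartialOrder X] [PartialOrder Y]
    (e : WithBot X ≃o WithBot Y) : Nonempty (X ≃o Y) := by
  have hne : ∀ x : X, ∃ y : Y, (y : WithBot Y) = e x := fun x =>
    WithBot.ne_bot_iff_exists.1 fun h => WithBot.coe_ne_bot (e.injective (h.trans e.map_bot.symm))
  choose g hg using hne
  refine ⟨OrderIso.ofSurjective (OrderEmbedding.ofMapLEIff g fun a b => ?_) fun y => ?_⟩
  · rw [← WithBot.coe_le_coe, hg, hg, e.le_iff_le, WithBot.coe_le_coe]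
  · obtain ⟨x, hx⟩ : ∃ x : X, (x : WithBot X) = e.symm y := WithBot.ne_bot_iff_exists.1 fun h =>
      WithBot.coe_ne_bot (e.symm.injective (h.trans e.symm.map_bot.symm))
    refine ⟨x, WithBot.coe_injective ?_⟩
    change (g x : WithBot Y) = y
    rw [hg, hx, e.apply_symm_apply]

theorem nonempty_orderIso_of_sum {A B C D : Type} [PartialOrder A] [PartialOrder B]
    [PartialOrder C] [PartialOrder D] (f : A ⊕ B ≃o C ⊕ D)
    (hA : ∀ a, ∃ c, f (Sum.inl a) = Sum.inl c) (hB : ∀ b, ∃ d, f (Sum.inr b) = Sum.inr d) :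
    Nonempty (A ≃o C) ∧ Nonempty (B ≃o D) := by
  choose g hg using hA
  choose h hh using hB
  refine ⟨⟨OrderIso.ofSurjective (OrderEmbedding.ofMapLEIff g fun a b => ?_) fun y => ?_⟩,
    ⟨OrderIso.ofSurjective (OrderEmbedding.ofMapLEIff h fun a b => ?_) fun y => ?_⟩⟩
  · rw [← Sum.inl_le_inl_iff (β := D), ← hg, ← hg, f.le_iff_le, Sum.inl_le_inl_iff]
  · obtain ⟨x | x, hx⟩ := f.surjective (Sum.inl y)
    · exact ⟨x, Sum.inl_injective ((hg x).symm.trans hx)⟩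
    · rw [hh] at hx; cases hx
  · rw [← Sum.inr_le_inr_iff (α := C), ← hh, ← hh, f.le_iff_le, Sum.inr_le_inr_iff]
  · obtain ⟨x | x, hx⟩ := f.surjective (Sum.inr y)
    · rw [hg] at hx; cases hx
    · exact ⟨x, Sum.inr_injective ((hh x).symm.trans hx)⟩

/-- A summand in which any two elements have a common lower bound is mapped into one summand. -/
theorem exists_inl_or_exists_inr {A X C D : Type} [PartialOrder A] [PartialOrder X]
    [PartialOrder C] [PartialOrder D] (hA : ∀ x y : A, ∃ z, z ≤ x ∧ z ≤ y) (f : X ≃o C ⊕ D)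
    (i : A ↪o X) : (∀ a, ∃ c, f (i a) = Sum.inl c) ∨ ∀ a, ∃ d, f (i a) = Sum.inr d := by
  by_contra! h
  obtain ⟨⟨a, ha⟩, ⟨b, hb⟩⟩ := h
  obtain ⟨z, hza, hzb⟩ := hA a b
  have h1 : f (i z) ≤ f (i a) := f.le_iff_le.2 (i.le_iff_le.2 hza)
  have h2 : f (i z) ≤ f (i b) := f.le_iff_le.2 (i.le_iff_le.2 hzb)
  rcases hfa : f (i a) with c | d
  · exact ha c hfa
  rcases hfb : f (i b) with c' | d'
  · rcases hfz : f (i z) with c'' | d''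
    · rw [hfa, hfz] at h1; exact Sum.not_inl_le_inr h1
    · rw [hfb, hfz] at h2; exact Sum.not_inr_le_inl h2
  · exact hb d' hfb

/-- The two summands of `A ⊕ B` cannot both be mapped into `C`, unless one of them is empty. -/
theorem isEmpty_of_map_inl {A B C D : Type} [PartialOrder A] [PartialOrder B]
    [PartialOrder C] [PartialOrder D] (hC : ∀ x y : C, ∃ z, z ≤ x ∧ z ≤ y) (f : A ⊕ B ≃o C ⊕ D)
    (hA : ∀ a, ∃ c, f (Sum.inl a) = Sum.inl c) (hB : ∀ b, ∃ c, f (Sum.inr b) = Sum.inl c) :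
    IsEmpty A ∨ IsEmpty B := by
  by_contra! h
  obtain ⟨⟨a⟩, ⟨b⟩⟩ := h
  obtain ⟨c, hc⟩ := hA a
  obtain ⟨c', hc'⟩ := hB b
  obtain ⟨z, hz, hz'⟩ := hC c c'
  obtain ⟨x, hx⟩ := f.surjective (Sum.inl z)
  have h1 : x ≤ Sum.inl a := by rw [← f.le_iff_le, hx, hc]; exact Sum.inl_le_inl_iff.2 hz
  have h2 : x ≤ Sum.inr b := by rw [← f.le_iff_le, hx, hc']; exact Sum.inl_le_inl_iff.2 hz'
  rcases x with x | x
  · exact Sum.not_inl_le_inr h2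
  · exact Sum.not_inr_le_inl h1

/-- The unordered pair of the summands is determined by the poset `A ⊕ B`, if any two elements of
the same summand have a common lower bound. -/
theorem nonempty_orderIso_sum_iff {A B C D : Type} [PartialOrder A] [PartialOrder B]
    [PartialOrder C] [PartialOrder D] (hA : ∀ x y : A, ∃ z, z ≤ x ∧ z ≤ y)
    (hB : ∀ x y : B, ∃ z, z ≤ x ∧ z ≤ y) (hC : ∀ x y : C, ∃ z, z ≤ x ∧ z ≤ y)
    (hD : ∀ x y : D, ∃ z, z ≤ x ∧ z ≤ y) :
    Nonempty (A ⊕ B ≃o C ⊕ D) ↔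
      (Nonempty (A ≃o C) ∧ Nonempty (B ≃o D)) ∨ (Nonempty (A ≃o D) ∧ Nonempty (B ≃o C)) := by
  constructor
  · rintro ⟨f⟩
    let f' : A ⊕ B ≃o D ⊕ C := f.trans (OrderIso.sumComm C D)
    have hf' : ∀ x c, f x = Sum.inl c → f' x = Sum.inr c := fun x c h => by
      change (OrderIso.sumComm C D) (f x) = _; rw [h]; rfl
    have hf'' : ∀ x d, f x = Sum.inr d → f' x = Sum.inl d := fun x c h => by
      change (OrderIso.sumComm C D) (f x) = _; rw [h]; rfl
    have straight : (∀ a, ∃ c, f (Sum.inl a) = Sum.inl c) → (∀ b, ∃ d, f (Sum.inr b) = Sum.inr d) →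
        (Nonempty (A ≃o C) ∧ Nonempty (B ≃o D)) ∨ (Nonempty (A ≃o D) ∧ Nonempty (B ≃o C)) :=
      fun h1 h2 => Or.inl (nonempty_orderIso_of_sum f h1 h2)
    have crossed : (∀ a, ∃ d, f (Sum.inl a) = Sum.inr d) → (∀ b, ∃ c, f (Sum.inr b) = Sum.inl c) →
        (Nonempty (A ≃o C) ∧ Nonempty (B ≃o D)) ∨ (Nonempty (A ≃o D) ∧ Nonempty (B ≃o C)) :=
      fun h1 h2 => Or.inr (nonempty_orderIso_of_sum f'
          (fun a => (h1 a).imp fun d => hf'' _ d) (fun b => (h2 b).imp fun c => hf' _ c))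
    rcases exists_inl_or_exists_inr hA f
        (OrderEmbedding.ofMapLEIff Sum.inl fun _ _ => Sum.inl_le_inl_iff) with h1 | h1 <;>
      rcases exists_inl_or_exists_inr hB f
        (OrderEmbedding.ofMapLEIff Sum.inr fun _ _ => Sum.inr_le_inr_iff) with h2 | h2
    · rcases isEmpty_of_map_inl hC f h1 h2 with h | h
      · exact crossed (fun a => isEmptyElim a) h2
      · exact straight h1 fun b => isEmptyElim b
    · exact straight h1 h2
    · exact crossed h1 h2
    · rcases isEmpty_of_map_inl hD f' (fun a => (h1 a).imp fun d => hf'' _ d)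
        (fun b => (h2 b).imp fun d => hf'' _ d) with h | h
      · exact straight (fun a => isEmptyElim a) h2
      · exact crossed h1 fun b => isEmptyElim b
  · rintro (⟨⟨e⟩, ⟨e'⟩⟩ | ⟨⟨e⟩, ⟨e'⟩⟩)
    · exact ⟨e.sumCongr e'⟩
    · exact ⟨(e.sumCongr e').trans (OrderIso.sumComm D C)⟩

theorem treePoset_codirected (T : BinaryTree Unit) (x y : treePoset T) :
    ∃ z, z ≤ x ∧ z ≤ y := by
  cases T with
  | nil => exact x.elim
  | node u l r =>
    have h : ∀ w : treePoset (.node u l r), (⊥ : WithBot (treePoset l ⊕ treePoset r)) ≤ w :=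
      fun w => bot_le (α := WithBot (treePoset l ⊕ treePoset r))
    exact ⟨_, h x, h y⟩

theorem nonempty_treePoset_node (u : Unit) (l r : BinaryTree Unit) :
    Nonempty (treePoset (.node u l r)) :=
  ⟨(⊥ : WithBot (treePoset l ⊕ treePoset r))⟩

theorem isEmpty_treePoset_nil : IsEmpty (treePoset .nil) := ⟨fun x => x.elim⟩

/-- The posets of two trees are isomorphic if and only if those of their sub-trees are, up to a
swap. -/
theorem nonempty_orderIso_node_iff {u u' : Unit} {l r l' r' : BinaryTree Unit} :
    Nonempty (treePoset (.node u l r) ≃o treePoset (.node u' l' r')) ↔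
      (Nonempty (treePoset l ≃o treePoset l') ∧ Nonempty (treePoset r ≃o treePoset r')) ∨
      (Nonempty (treePoset l ≃o treePoset r') ∧ Nonempty (treePoset r ≃o treePoset l')) := by
  rw [← nonempty_orderIso_sum_iff (treePoset_codirected l) (treePoset_codirected r)
    (treePoset_codirected l') (treePoset_codirected r')]
  exact ⟨fun ⟨e⟩ => nonempty_orderIso_of_withBot e, fun ⟨e⟩ => ⟨e.withBotCongr⟩⟩

instance finite_treePoset (T : BinaryTree Unit) : Finite (treePoset T) := by
  induction T with
  | nil => exact inferInstanceAs (Finite Empty)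
  | node u l r _ _ => exact inferInstanceAs (Finite (Option (treePoset l ⊕ treePoset r)))

/-! ### Maximal and symmetric elements of the posets of trees -/

section UpperSet

variable {A X : Type} [PartialOrder A] [PartialOrder X] (f : A ↪o X)

/-- An order embedding `f` onto an upper set preserves all notions that only refer to the elements
above a given one: covers, and maximal and symmetric elements. -/
theorem covBy_upper_iff (hf : ∀ a x, f a ≤ x → ∃ b, f b = x) {a : A} {w : X} :
    f a ⋖ w ↔ ∃ b, f b = w ∧ a ⋖ b := by
  constructor
  · intro h
    obtain ⟨b, rfl⟩ := hf a w h.1.le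
    exact ⟨b, rfl, f.lt_iff_lt.1 h.1, fun c h1 h2 => h.2 (f.lt_iff_lt.2 h1) (f.lt_iff_lt.2 h2)⟩
  · rintro ⟨b, rfl, h⟩
    refine ⟨f.lt_iff_lt.2 h.1, fun c h1 h2 => ?_⟩
    obtain ⟨c, rfl⟩ := hf a c h1.le
    exact h.2 (f.lt_iff_lt.1 h1) (f.lt_iff_lt.1 h2)

theorem nonempty_Ici_orderIso (hf : ∀ a x, f a ≤ x → ∃ b, f b = x) (a : A) :
    Nonempty (Set.Ici a ≃o Set.Ici (f a)) := by
  refine ⟨OrderIso.ofSurjective (OrderEmbedding.ofMapLEIff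
    (fun b : Set.Ici a => (⟨f b.1, f.le_iff_le.2 b.2⟩ : Set.Ici (f a)))
    fun b c => f.le_iff_le) fun x => ?_⟩
  obtain ⟨b, hb⟩ := hf a x.1 x.2
  exact ⟨⟨b, f.le_iff_le.1 (hb.symm ▸ x.2)⟩, Subtype.ext hb⟩

theorem forall_not_covBy_upper_iff (hf : ∀ a x, f a ≤ x → ∃ b, f b = x) {a : A} :
    (∀ w, ¬ f a ⋖ w) ↔ ∀ b, ¬ a ⋖ b := by
  simp only [covBy_upper_iff f hf]
  exact ⟨fun h b hb => h _ ⟨b, rfl, hb⟩, fun h w ⟨b, _, hb⟩ => h b hb⟩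

theorem isSymmetricElt_upper_iff (hf : ∀ a x, f a ≤ x → ∃ b, f b = x) {a : A} :
    IsSymmetricElt (f a) ↔ IsSymmetricElt a := by
  constructor
  · rintro ⟨v₁, v₂, hne, h1, h2, ⟨e⟩⟩
    obtain ⟨b₁, rfl, hb₁⟩ := (covBy_upper_iff f hf).1 h1
    obtain ⟨b₂, rfl, hb₂⟩ := (covBy_upper_iff f hf).1 h2
    obtain ⟨e1⟩ := nonempty_Ici_orderIso f hf b₁
    obtain ⟨e2⟩ := nonempty_Ici_orderIso f hf b₂
    exact ⟨b₁, b₂, fun h => hne (h ▸ rfl), hb₁, hb₂, ⟨(e1.trans e).trans e2.symm⟩⟩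
  · rintro ⟨b₁, b₂, hne, h1, h2, ⟨e⟩⟩
    obtain ⟨e1⟩ := nonempty_Ici_orderIso f hf b₁
    obtain ⟨e2⟩ := nonempty_Ici_orderIso f hf b₂
    exact ⟨f b₁, f b₂, f.injective.ne hne, (covBy_upper_iff f hf).2 ⟨_, rfl, h1⟩,
      (covBy_upper_iff f hf).2 ⟨_, rfl, h2⟩, ⟨(e1.symm.trans e).trans e2⟩⟩

end UpperSet

/-- The inclusion of the left summand into `A ⊕ B` with a new least element. -/
def inlWithBot (A B : Type) [PartialOrder A] [PartialOrder B] : A ↪o WithBot (A ⊕ B) :=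
  OrderEmbedding.ofMapLEIff (fun a => ((Sum.inl a : A ⊕ B) : WithBot (A ⊕ B))) fun _ _ =>
    WithBot.coe_le_coe.trans Sum.inl_le_inl_iff

/-- The inclusion of the right summand into `A ⊕ B` with a new least element. -/
def inrWithBot (A B : Type) [PartialOrder A] [PartialOrder B] : B ↪o WithBot (A ⊕ B) :=
  OrderEmbedding.ofMapLEIff (fun b => ((Sum.inr b : A ⊕ B) : WithBot (A ⊕ B))) fun _ _ =>
    WithBot.coe_le_coe.trans Sum.inr_le_inr_iff

theorem inlWithBot_upper {A B : Type} [PartialOrder A] [PartialOrder B] (a : A)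
    (x : WithBot (A ⊕ B)) (h : inlWithBot A B a ≤ x) : ∃ b, inlWithBot A B b = x := by
  induction x using WithBot.recBotCoe with
  | bot => exact absurd h (WithBot.not_coe_le_bot _)
  | coe x =>
    rcases x with x | x
    · exact ⟨x, rfl⟩
    · exact absurd (WithBot.coe_le_coe.1 h) Sum.not_inl_le_inr

theorem inrWithBot_upper {A B : Type} [PartialOrder A] [PartialOrder B] (b : B)
    (x : WithBot (A ⊕ B)) (h : inrWithBot A B b ≤ x) : ∃ c, inrWithBot A B c = x := by
  induction x using WithBot.recBotCoe with
  | bot => exact absurd h (WithBot.not_coe_le_bot _)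
  | coe x =>
    rcases x with x | x
    · exact absurd (WithBot.coe_le_coe.1 h) Sum.not_inr_le_inl
    · exact ⟨x, rfl⟩

open Classical in
theorem natCard_subtype_withBot_sum {A B : Type} [PartialOrder A] [PartialOrder B] [Finite A]
    [Finite B] (P : WithBot (A ⊕ B) → Prop) :
    Nat.card {x // P x} = (if P ⊥ then 1 else 0) + (Nat.card {a // P (inlWithBot A B a)} +
      Nat.card {b // P (inrWithBot A B b)}) := by
  have key : ∀ (α : Type) [Fintype α] (Q : α → Prop),
      Nat.card {x // Q x} = ∑ x, if Q x then 1 else 0 := fun α _ Q => by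
    rw [Nat.card_eq_fintype_card, Fintype.card_subtype, Finset.card_filter]
  have := Fintype.ofFinite A
  have := Fintype.ofFinite B
  rw [key A, key B]
  have h := key (Option (A ⊕ B)) P
  rw [Fintype.sum_option, Fintype.sum_sum_type] at h
  exact h

theorem exists_isMin_of_finite {A : Type} [PartialOrder A] [Finite A] [Nonempty A] :
    ∃ a : A, IsMin a := by
  obtain ⟨a, ha⟩ := exists_minimal_of_wellFoundedLT (fun _ : A => True)
    ⟨Classical.arbitrary A, trivial⟩
  exact ⟨a, fun b hb => ha.2 trivial hb⟩

theorem le_of_isMin {A : Type} [PartialOrder A] (hA : ∀ x y : A, ∃ z, z ≤ x ∧ z ≤ y) {a : A}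
    (ha : IsMin a) (x : A) : a ≤ x := by
  obtain ⟨z, hz, hz'⟩ := hA a x
  exact (ha hz).trans hz'

theorem nonempty_Ici_orderIso_of_isMin {A : Type} [PartialOrder A]
    (hA : ∀ x y : A, ∃ z, z ≤ x ∧ z ≤ y) {a : A} (ha : IsMin a) :
    Nonempty (Set.Ici a ≃o A) :=
  ⟨OrderIso.ofSurjective (OrderEmbedding.ofMapLEIff (fun x : Set.Ici a => x.1) fun _ _ => Iff.rfl)
    fun x => ⟨⟨x, le_of_isMin hA ha x⟩, rfl⟩⟩

theorem bot_covBy_inl_iff {A B : Type} [PartialOrder A] [PartialOrder B] {a : A} :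
    (⊥ : WithBot (A ⊕ B)) ⋖ inlWithBot A B a ↔ IsMin a := by
  refine WithBot.bot_covBy_coe.trans ?_
  refine ⟨fun h b hb => ?_, fun h x hx => ?_⟩
  · exact Sum.inl_le_inl_iff.1 (h (Sum.inl_le_inl_iff.2 hb))
  · rcases x with x | x
    · exact Sum.inl_le_inl_iff.2 (h (Sum.inl_le_inl_iff.1 hx))
    · exact absurd hx Sum.not_inr_le_inl

theorem bot_covBy_inr_iff {A B : Type} [PartialOrder A] [PartialOrder B] {b : B} :
    (⊥ : WithBot (A ⊕ B)) ⋖ inrWithBot A B b ↔ IsMin b := by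
  refine WithBot.bot_covBy_coe.trans ?_
  refine ⟨fun h a ha => ?_, fun h x hx => ?_⟩
  · exact Sum.inr_le_inr_iff.1 (h (Sum.inr_le_inr_iff.2 ha))
  · rcases x with x | x
    · exact absurd hx Sum.not_inl_le_inr
    · exact Sum.inr_le_inr_iff.2 (h (Sum.inr_le_inr_iff.1 hx))

theorem eq_inl_or_inr_of_bot_covBy {A B : Type} [PartialOrder A] [PartialOrder B]
    {x : WithBot (A ⊕ B)} (h : ⊥ ⋖ x) :
    (∃ a, IsMin a ∧ x = inlWithBot A B a) ∨ ∃ b, IsMin b ∧ x = inrWithBot A B b := by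
  induction x using WithBot.recBotCoe with
  | bot => exact absurd h.1 (lt_irrefl _)
  | coe x =>
    rcases x with x | x
    · exact Or.inl ⟨x, bot_covBy_inl_iff.1 h, rfl⟩
    · exact Or.inr ⟨x, bot_covBy_inr_iff.1 h, rfl⟩

theorem forall_not_bot_covBy_iff {A B : Type} [PartialOrder A] [PartialOrder B] [Finite A]
    [Finite B] : (∀ x : WithBot (A ⊕ B), ¬ ⊥ ⋖ x) ↔ IsEmpty A ∧ IsEmpty B := by
  constructor
  · refine fun h => ⟨?_, ?_⟩
    · by_contra! hne
      obtain ⟨a, ha⟩ := exists_isMin_of_finite (A := A)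
      exact h _ (bot_covBy_inl_iff.2 ha)
    · by_contra! hne
      obtain ⟨b, hb⟩ := exists_isMin_of_finite (A := B)
      exact h _ (bot_covBy_inr_iff.2 hb)
  · rintro ⟨hA, hB⟩ x hx
    rcases eq_inl_or_inr_of_bot_covBy hx with ⟨a, -⟩ | ⟨b, -⟩
    · exact hA.false a
    · exact hB.false b

theorem isSymmetricElt_bot_iff {A B : Type} [PartialOrder A] [PartialOrder B] [Finite A]
    (hA : ∀ x y : A, ∃ z, z ≤ x ∧ z ≤ y) (hB : ∀ x y : B, ∃ z, z ≤ x ∧ z ≤ y) :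
    IsSymmetricElt (⊥ : WithBot (A ⊕ B)) ↔ Nonempty A ∧ Nonempty (A ≃o B) := by
  have build : ∀ {a : A} {b : B}, IsMin a → IsMin b →
      (Nonempty (Set.Ici (inlWithBot A B a) ≃o Set.Ici (inrWithBot A B b)) ↔
        Nonempty (A ≃o B)) := by
    intro a b ha hb
    obtain ⟨e1⟩ := nonempty_Ici_orderIso (inlWithBot A B) inlWithBot_upper a
    obtain ⟨e2⟩ := nonempty_Ici_orderIso (inrWithBot A B) inrWithBot_upper b
    obtain ⟨e3⟩ := nonempty_Ici_orderIso_of_isMin hA ha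
    obtain ⟨e4⟩ := nonempty_Ici_orderIso_of_isMin hB hb
    exact ⟨fun ⟨e⟩ => ⟨((e3.symm.trans e1).trans e).trans (e2.symm.trans e4)⟩,
      fun ⟨e⟩ => ⟨((e1.symm.trans e3).trans e).trans (e4.symm.trans e2)⟩⟩
  constructor
  · rintro ⟨v₁, v₂, hne, h1, h2, he⟩
    rcases eq_inl_or_inr_of_bot_covBy h1 with ⟨a, ha, rfl⟩ | ⟨b, hb, rfl⟩ <;>
      rcases eq_inl_or_inr_of_bot_covBy h2 with ⟨a', ha', rfl⟩ | ⟨b', hb', rfl⟩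
    · exact absurd (congrArg _ (le_antisymm (le_of_isMin hA ha a') (le_of_isMin hA ha' a))) hne
    · exact ⟨⟨a⟩, (build ha hb').1 he⟩
    · exact ⟨⟨a'⟩, (build ha' hb).1 (he.map OrderIso.symm)⟩
    · exact absurd (congrArg _ (le_antisymm (le_of_isMin hB hb b') (le_of_isMin hB hb' b))) hne
  · rintro ⟨hne, ⟨e⟩⟩
    obtain ⟨a, ha⟩ := exists_isMin_of_finite (A := A)
    have hb : IsMin (e a) := fun b hb => by
      have := ha (e.symm_apply_apply a ▸ e.symm.monotone hb)
      rwa [← e.le_iff_le, e.apply_symm_apply] at this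
    exact ⟨inlWithBot A B a, inrWithBot A B (e a),
      fun h => Sum.inl_ne_inr (WithBot.coe_injective h), bot_covBy_inl_iff.2 ha,
      bot_covBy_inr_iff.2 hb, (build ha hb).2 ⟨e⟩⟩

open Classical in
theorem numMaximal_withBot_sum {A B : Type} [PartialOrder A] [PartialOrder B] [Finite A]
    [Finite B] : numMaximal (WithBot (A ⊕ B)) =
      (if IsEmpty A ∧ IsEmpty B then 1 else 0) + (numMaximal A + numMaximal B) := by
  refine (natCard_subtype_withBot_sum _).trans ?_
  simp only [forall_not_bot_covBy_iff,
    forall_not_covBy_upper_iff (inlWithBot A B) inlWithBot_upper,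
    forall_not_covBy_upper_iff (inrWithBot A B) inrWithBot_upper]
  rfl

open Classical in
theorem numSymmetric_withBot_sum {A B : Type} [PartialOrder A] [PartialOrder B] [Finite A]
    [Finite B] (hA : ∀ x y : A, ∃ z, z ≤ x ∧ z ≤ y) (hB : ∀ x y : B, ∃ z, z ≤ x ∧ z ≤ y) :
    numSymmetric (WithBot (A ⊕ B)) =
      (if Nonempty A ∧ Nonempty (A ≃o B) then 1 else 0) + (numSymmetric A + numSymmetric B) := by
  refine (natCard_subtype_withBot_sum _).trans ?_
  simp only [isSymmetricElt_bot_iff hA hB,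
    isSymmetricElt_upper_iff (inlWithBot A B) inlWithBot_upper,
    isSymmetricElt_upper_iff (inrWithBot A B) inrWithBot_upper]
  rfl

open Classical in
theorem numMaximal_node (u : Unit) (l r : BinaryTree Unit) :
    numMaximal (treePoset (.node u l r)) =
      (if IsEmpty (treePoset l) ∧ IsEmpty (treePoset r) then 1 else 0) +
        (numMaximal (treePoset l) + numMaximal (treePoset r)) :=
  numMaximal_withBot_sum

open Classical in
theorem numSymmetric_node (u : Unit) (l r : BinaryTree Unit) :
    numSymmetric (treePoset (.node u l r)) =
      (if Nonempty (treePoset l) ∧ Nonempty (treePoset l ≃o treePoset r) then 1 else 0) +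
        (numSymmetric (treePoset l) + numSymmetric (treePoset r)) :=
  numSymmetric_withBot_sum (treePoset_codirected l) (treePoset_codirected r)

/-! ### Counting the trees with a given poset -/

/-- The binary trees that arise from `T` by swapping the left and the right sub-tree at some of
the internal vertices. -/
def treeVariants : BinaryTree Unit → Finset (BinaryTree Unit)
  | .nil => {.nil}
  | .node _ l r => BinaryTree.pairwiseNode (treeVariants l) (treeVariants r) ∪
      BinaryTree.pairwiseNode (treeVariants r) (treeVariants l)

theorem node_mem_pairwiseNode {a b : Finset (BinaryTree Unit)} {u : Unit} {l r : BinaryTree Unit} :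
    .node u l r ∈ BinaryTree.pairwiseNode a b ↔ l ∈ a ∧ r ∈ b := by
  rw [BinaryTree.pairwiseNode, Finset.mem_map]
  constructor
  · rintro ⟨⟨l', r'⟩, h, he⟩
    obtain ⟨-, rfl, rfl⟩ := BinaryTree.node.inj he
    exact Finset.mem_product.1 h
  · exact fun h => ⟨(l, r), Finset.mem_product.2 h, rfl⟩

theorem nil_notMem_pairwiseNode {a b : Finset (BinaryTree Unit)} :
    .nil ∉ BinaryTree.pairwiseNode a b := by
  rw [BinaryTree.pairwiseNode, Finset.mem_map]
  rintro ⟨x, -, he⟩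
  cases he

/-- The variants of `T` are the trees whose poset is isomorphic to that of `T`. -/
theorem mem_treeVariants_iff {T T' : BinaryTree Unit} :
    T' ∈ treeVariants T ↔ Nonempty (treePoset T' ≃o treePoset T) := by
  induction T generalizing T' with
  | nil =>
    rw [treeVariants, Finset.mem_singleton]
    cases T' with
    | nil => exact iff_of_true rfl ⟨OrderIso.refl _⟩
    | node u l r =>
      refine iff_of_false (by simp) fun ⟨e⟩ => ?_
      obtain ⟨x⟩ := nonempty_treePoset_node u l r
      exact isEmpty_treePoset_nil.false (e x)
  | node u l r hl hr =>
    rw [treeVariants, Finset.mem_union]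
    cases T' with
    | nil =>
      refine iff_of_false (by simp) fun ⟨e⟩ => ?_
      obtain ⟨x⟩ := nonempty_treePoset_node u l r
      exact isEmpty_treePoset_nil.false (e.symm x)
    | node u' l' r' =>
      rw [node_mem_pairwiseNode, node_mem_pairwiseNode, hl, hr, hr, hl,
        nonempty_orderIso_node_iff]

theorem numNodes_of_mem_treeVariants {T T' : BinaryTree Unit} (h : T' ∈ treeVariants T) :
    T'.numNodes = T.numNodes := by
  induction T generalizing T' with
  | nil => rw [treeVariants, Finset.mem_singleton] at h; rw [h]
  | node u l r hl hr =>
    rw [treeVariants, Finset.mem_union] at h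
    cases T' with
    | nil => simp at h
    | node u' l' r' =>
      rw [node_mem_pairwiseNode, node_mem_pairwiseNode] at h
      simp only [BinaryTree.numNodes]
      rcases h with h | h
      · rw [hl h.1, hr h.2]
      · rw [hr h.1, hl h.2, add_comm r.numNodes]

/-- Of the `2 ^ n` ways to swap sub-trees, the swaps at maximal and at symmetric elements change
nothing. -/
theorem card_treeVariants (T : BinaryTree Unit) :
    (treeVariants T).card * 2 ^ (numMaximal (treePoset T) + numSymmetric (treePoset T)) =
      2 ^ T.numNodes := by
  induction T with
  | nil =>
    have h1 : numMaximal (treePoset .nil) = 0 := by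
      have := isEmpty_treePoset_nil
      exact Nat.card_of_isEmpty
    have h2 : numSymmetric (treePoset .nil) = 0 := by
      have := isEmpty_treePoset_nil
      exact Nat.card_of_isEmpty
    rw [h1, h2]
    rfl
  | node u l r hl hr =>
    have hP : ∀ a b, (BinaryTree.pairwiseNode a b).card = a.card * b.card := fun a b => by
      rw [BinaryTree.pairwiseNode, Finset.card_map, Finset.card_product]
    rw [numMaximal_node, numSymmetric_node, treeVariants]
    simp only [BinaryTree.numNodes]
    rw [pow_succ, pow_add 2 l.numNodes, ← hl, ← hr]
    by_cases hiso : Nonempty (treePoset l ≃o treePoset r)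
    · have hV : treeVariants l = treeVariants r := by
        obtain ⟨e⟩ := hiso
        ext T
        rw [mem_treeVariants_iff, mem_treeVariants_iff]
        exact ⟨fun ⟨e'⟩ => ⟨e'.trans e⟩, fun ⟨e'⟩ => ⟨e'.trans e.symm⟩⟩
      -- exactly one of the two conditional terms is `1`, as the root is maximal or symmetric
      have hone : (IsEmpty (treePoset l) ∧ IsEmpty (treePoset r)) ↔
          ¬ (Nonempty (treePoset l) ∧ Nonempty (treePoset l ≃o treePoset r)) := by
        obtain ⟨e⟩ := id hiso
        simp only [hiso, and_true, not_nonempty_iff]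
        exact ⟨And.left, fun h => ⟨h, e.symm.toEquiv.isEmpty⟩⟩
      rw [hV, Finset.union_self, hP]
      by_cases hc : Nonempty (treePoset l) ∧ Nonempty (treePoset l ≃o treePoset r)
      · rw [if_neg (fun h => hone.1 h hc), if_pos hc]; ring
      · rw [if_pos (hone.2 hc), if_neg hc]; ring
    · have hne : ¬ (IsEmpty (treePoset l) ∧ IsEmpty (treePoset r)) := fun ⟨h, h'⟩ =>
        hiso ⟨⟨Equiv.equivOfIsEmpty _ _, fun {a} => isEmptyElim a⟩⟩
      have hdisj : Disjoint (BinaryTree.pairwiseNode (treeVariants l) (treeVariants r))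
          (BinaryTree.pairwiseNode (treeVariants r) (treeVariants l)) := by
        refine Finset.disjoint_left.2 fun T h h' => hiso ?_
        cases T with
        | nil => exact absurd h nil_notMem_pairwiseNode
        | node u a b =>
          obtain ⟨e⟩ := mem_treeVariants_iff.1 (node_mem_pairwiseNode.1 h).1
          obtain ⟨e'⟩ := mem_treeVariants_iff.1 (node_mem_pairwiseNode.1 h').1
          exact ⟨e.symm.trans e'⟩
      rw [Finset.card_union_of_disjoint hdisj, hP, hP, if_neg hne, if_neg fun h => hiso h.2]
      ring

/-! ### The Brion map on associahedra -/

/-- The isomorphism class of the poset of a tree. -/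
def treeClass {n : ℕ} (T : TreesWithNodes n) : UnlabelledPoset n :=
  Quotient.mk (posetIso n) (treeOrder T)

theorem treeClass_eq_iff {n : ℕ} (T T' : TreesWithNodes n) :
    treeClass T = treeClass T' ↔ T.1 ∈ treeVariants T'.1 := by
  obtain ⟨e⟩ := nonempty_orderIso_treeOrder T
  obtain ⟨e'⟩ := nonempty_orderIso_treeOrder T'
  rw [mem_treeVariants_iff]
  refine (Quotient.eq (r := posetIso n)).trans ?_
  constructor
  · rintro ⟨f⟩
    exact ⟨@OrderIso.trans _ _ _ _ (treeOrder T').toLE _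
      (@OrderIso.trans _ _ _ _ (treeOrder T).toLE (treeOrder T').toLE
        (@OrderIso.symm _ _ (treeOrder T).toLE _ e) f) e'⟩
  · rintro ⟨f⟩
    exact ⟨@OrderIso.trans _ _ _ (treeOrder T).toLE _ (treeOrder T').toLE e
      (@OrderIso.trans _ _ _ _ _ (treeOrder T').toLE f (@OrderIso.symm _ _ (treeOrder T').toLE _ e'))⟩

theorem mem_RBT_iff {n : ℕ} {c : UnlabelledPoset n} : c ∈ RBT n ↔ ∃ T, treeClass (n := n) T = c := by
  rw [RBT, Set.Finite.mem_toFinset]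
  constructor
  · rintro ⟨T, hn, p, ⟨e⟩, rfl⟩
    obtain ⟨e'⟩ := nonempty_orderIso_treeOrder (⟨T, hn⟩ : TreesWithNodes n)
    refine ⟨⟨T, hn⟩, Quotient.sound ⟨?_⟩⟩
    exact @OrderIso.trans _ _ _ (treeOrder ⟨T, hn⟩).toLE _ p.toLE e' (@OrderIso.symm _ _ p.toLE _ e)
  · rintro ⟨T, rfl⟩
    exact ⟨T.1, T.2, treeOrder T, nonempty_orderIso_treeOrder T, rfl⟩

open Classical in
/-- The number of trees with a given poset. -/
theorem card_treeClass_eq (K : Type u) [Field K] [CharZero K] {n : ℕ} {c : UnlabelledPoset n}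
    (hc : c ∈ RBT n) :
    ((Finset.univ.filter fun T : TreesWithNodes n => treeClass T = c).card : K) =
      2 ^ ((n : ℤ) - (c.m : ℤ) - (c.s : ℤ)) := by
  obtain ⟨T, rfl⟩ := mem_RBT_iff.1 hc
  obtain ⟨e⟩ := nonempty_orderIso_treeOrder T
  have hm : (treeClass T).m = numMaximal (treePoset T.1) :=
    @numMaximal_congr _ _ (treeOrder T) _ e
  have hs : (treeClass T).s = numSymmetric (treePoset T.1) :=
    @numSymmetric_congr _ _ (treeOrder T) _ e
  have hcard : (Finset.univ.filter fun S : TreesWithNodes n => treeClass S = treeClass T).card =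
      (treeVariants T.1).card := by
    refine Finset.card_bij (fun S _ => S.1) (fun S hS => ?_) (fun S _ S' _ h => Subtype.ext h)
      fun S hS => ?_
    · exact (treeClass_eq_iff S T).1 (Finset.mem_filter.1 hS).2
    · exact ⟨⟨S, (numNodes_of_mem_treeVariants hS).trans T.2⟩,
        Finset.mem_filter.2 ⟨Finset.mem_univ _, (treeClass_eq_iff _ T).2 hS⟩, rfl⟩
  have h := congrArg (Nat.cast : ℕ → K) (card_treeVariants T.1)
  rw [T.2] at h
  push_cast at h
  have h2 : (2 : K) ≠ 0 := two_ne_zero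
  rw [hcard, hm, hs, sub_sub, zpow_sub₀ h2, eq_div_iff (zpow_ne_zero _ h2)]
  exact_mod_cast h

/-- The Brion map sends the associahedron to the sum of the posets of all binary trees. -/
theorem brionAssoc_assocClass (K : Type u) [Field K] (n : ℕ) :
    brionAssoc K (assocClass K n) = ∑ T : TreesWithNodes n, (treeClass T).toFock K := by
  have h : brionAssoc K (assocClass K n) =
      fockMk (posetSpecies K) n (brionSum K (assocGP (Fin n))) := by
    have h0 : (brion K).app (Fin n) (assocElt K (Fin n)).1 = brionSum K (assocGP (Fin n)) :=
      (Finsupp.linearCombination_single K 1 _).trans (one_smul K _)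
    rw [← h0]
    exact DirectSum.lmap_lof _ n _
  rw [h, brionSum_assocGP K treeOrder (treeOrder_injective n) isSearchOrder_iff_exists_treeOrder]
  exact map_sum (fockMk (posetSpecies K) n)
    (fun T : TreesWithNodes n => (Finsupp.single (treeOrder T) 1 : PartialOrder (Fin n) →₀ K))
    Finset.univ

end BrionMap

theorem mainTheorem4 (K : Type*) [Field K] [CharZero K] (n : ℕ) :
    BrionMap.brionAssoc K (BrionMap.assocClass K n) =
      ∑ p ∈ BrionMap.RBT n, (2 : K) ^ ((n : ℤ) - (p.m : ℤ) - (p.s : ℤ)) • p.toFock K := by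
  classical
  rw [BrionMap.brionAssoc_assocClass, ← Finset.sum_fiberwise_of_maps_to
    (g := BrionMap.treeClass) fun T _ => BrionMap.mem_RBT_iff.2 ⟨T, rfl⟩]
  refine Finset.sum_congr rfl fun c hc => ?_
  rw [← BrionMap.card_treeClass_eq K hc, Finset.sum_congr rfl fun T hT => by
    rw [(Finset.mem_filter.1 hT).2], Finset.sum_const, Nat.cast_smul_eq_nsmul]
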